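/- Let $\Omega\subset\mathbb R^2$ be a domain, $\vec F=(F_1,F_2)\in C^1(\Omega;\mathbb R^2)$, $H\in C^0(\Omega)$ and $u\in C^1(\Omega)$ with $D:=|\nabla u+\vec F|\neq 0$ everywhere in $\Omega$ ($\Omega$ is nonsingular). Put $N:=(\nabla u+\vec F)/D$, write $(a,b)^\perp:=(b,-a)$ for the rotation by $-\pi/2$, so that $N^\perp$ is $N$ rotated by $-\pi/2$, and $\operatorname{rot}\vec F:=(F_2)_x-(F_1)_y$. Integral curves of $N^\perp$ are called characteristic curves, integral curves of $N$ seed curves; $Nf$ (resp. $N^\perp g$) denotes the derivative of $f$ along seed curves (resp. of $g$ along characteristic curves) with respect to arc length. Suppose that $\operatorname{div}N=H$ in the weak sense: $$\int_\Omega N\cdot\nabla\varphi+\int_\Omega H\varphi=0\qquad\text{for all }\varphi\in C_0^\infty(\Omega).$$ Then for every $p_0\in\Omega$ there exist an open neighborhood $\Omega'\subset\Omega$ of $p_0$ and real functions $s,t\in C^1(\Omega')$ such that the (nonempty) level sets $\{t=\text{const}\}$ and $\{s=\text{const}\}$ in $\Omega'$ are characteristic curves and seed curves, respectively, and there are positive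 functions $f,g\in C^0(\Omega')$ such that $$\nabla s=fN^\perp,\qquad \nabla t=gDN \qquad\text{in }\Omega'.$$ Moreover $Nf$ and $N^\perp g$ exist and are continuous in $\Omega'$, and $$Nf+fH=0,\qquad N^\perp g+\frac{(\operatorname{rot}\vec F)\,g}{D}=0\qquad\text{in }\Omega'.$$ Finally, there is a neighborhood $\Omega''\subset\Omega'$ of $p_0$ such that $\Psi:(x,y)\in\Omega''\mapsto(s,t)\in\Psi(\Omega'')$ is a $C^1$ diffeomorphism with $$\Psi^*\Big(\frac{ds^2}{f^2}+\frac{dt^2}{g^2D^2}\Big)=dx^2+dy^2.$$ -/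

import Mathlib

open Set MeasureTheory
open scoped ContDiff

noncomputable section

namespace PMean

/-- The Euclidean plane with coordinates `x = p 0`, `y = p 1`. -/
abbrev Plane : Type := EuclideanSpace ℝ (Fin 2)

/-- Rotation by `-π/2`: `(a, b) ↦ (b, -a)`. -/
def perp (v : Plane) : Plane := !₂[v 1, -v 0]

/-- `rot F = ∂ₓ F₂ - ∂ᵧ F₁`. -/
def rot (F : Plane → Plane) (p : Plane) : ℝ :=
  fderiv ℝ F p !₂[1, 0] 1 - fderiv ℝ F p !₂[0, 1] 0

/-- The density `D = |∇u + F|`. -/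
def density (u : Plane → ℝ) (F : Plane → Plane) (p : Plane) : ℝ :=
  ‖gradient u p + F p‖

/-- The horizontal normal `N = (∇u + F) / |∇u + F|`. -/
def normal (u : Plane → ℝ) (F : Plane → Plane) (p : Plane) : Plane :=
  (density u F p)⁻¹ • (gradient u p + F p)

/-- The rotated horizontal normal `N^⊥`. -/
def normalPerp (u : Plane → ℝ) (F : Plane → Plane) (p : Plane) : Plane :=
  perp (normal u F p)

/-- The singular set of `u` in `Ω`: the points where `∇u + F = 0`. -/
def singularSet (u : Plane → ℝ) (F : Plane → Plane) (Ω : Set Plane) : Set Plane :=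
  {p ∈ Ω | gradient u p + F p = 0}

/-- `div N = H` on `Ω` in the weak sense: `∫_Ω N · ∇φ + ∫_Ω H φ = 0` for every
`φ ∈ C₀^∞(Ω)`. -/
def DivEqWeakly (N : Plane → Plane) (H : Plane → ℝ) (Ω : Set Plane) : Prop :=
  ∀ φ : Plane → ℝ, ContDiff ℝ ∞ φ → HasCompactSupport φ → tsupport φ ⊆ Ω →
    (∫ p in Ω, inner ℝ (N p) (gradient φ p)) + ∫ p in Ω, H p * φ p = 0

/-- `C` is (the trace of) an integral curve of the vector field `X`, parametrized over a
nonempty open interval. For `X = N^⊥` these are the characteristic curves, for `X = N` the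
seed curves. -/
def IsIntegralCurveTrace (X : Plane → Plane) (C : Set Plane) : Prop :=
  ∃ (I : Set ℝ) (γ : ℝ → Plane), IsOpen I ∧ I.OrdConnected ∧ I.Nonempty ∧
    IsIntegralCurveOn γ (fun _ => X) I ∧ γ '' I = C

/-- The derivative `X h` of `h : U → ℝ` at `p` along the integral curves of `X` in `U` exists
and equals `a`: some integral curve of `X` in `U` passes through `p`, and for each such curve
`γ`, with `γ σ₀ = p`, the function `h ∘ γ` has derivative `a` at `σ₀`. -/
def HasDerivAlong (X : Plane → Plane) (U : Set Plane) (h : Plane → ℝ) (a : ℝ)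
    (p : Plane) : Prop :=
  (∃ C : Set Plane, IsIntegralCurveTrace X C ∧ C ⊆ U ∧ p ∈ C) ∧
  ∀ (I : Set ℝ) (γ : ℝ → Plane), IsOpen I → I.OrdConnected →
    IsIntegralCurveOn γ (fun _ => X) I → MapsTo γ I U →
    ∀ σ₀ ∈ I, γ σ₀ = p → HasDerivAt (fun σ => h (γ σ)) a σ₀

/-- `Ψ` restricts to a `C¹` diffeomorphism of the open set `U` onto the open set `Ψ(U)`, with
inverse `Φ`. -/
def IsC1DiffeoOn (Ψ Φ : Plane → Plane) (U : Set Plane) : Prop :=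
  IsOpen U ∧ IsOpen (Ψ '' U) ∧ ContDiffOn ℝ 1 Ψ U ∧ ContDiffOn ℝ 1 Φ (Ψ '' U) ∧
    LeftInvOn Φ Ψ U

/-- The `i`-th coordinate differential on the plane. -/
def coordDiff (i : Fin 2) : Plane →ₗ[ℝ] ℝ := (EuclideanSpace.proj i : Plane →L[ℝ] ℝ)

/-- The field of bilinear forms `a ds² + b dt²`, `(s, t)` being the standard coordinates of
the target plane. -/
def diagMetric (a b : Plane → ℝ) (q : Plane) : LinearMap.BilinForm ℝ Plane :=
  a q • LinearMap.BilinForm.linMulLin (coordDiff 0) (coordDiff 0) +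
    b q • LinearMap.BilinForm.linMulLin (coordDiff 1) (coordDiff 1)

/-- The Euclidean metric `dx² + dy²`. -/
def euclMetric : Plane → LinearMap.BilinForm ℝ Plane := diagMetric (fun _ => 1) (fun _ => 1)

/-- The pullback `Ψ^* G` of a field of bilinear forms. -/
def pullbackMetric (Ψ : Plane → Plane) (G : Plane → LinearMap.BilinForm ℝ Plane)
    (p : Plane) : LinearMap.BilinForm ℝ Plane :=
  LinearMap.BilinForm.comp (G (Ψ p)) (fderiv ℝ Ψ p : Plane →ₗ[ℝ] Plane)
    (fderiv ℝ Ψ p : Plane →ₗ[ℝ] Plane)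

end PMean

end

noncomputable section

namespace PMean

open Filter Topology Metric
open scoped NNReal

/-! The difficulty is regularity: `N` is only continuous, so its integral curves need not be unique
a priori and no flow is at hand. The divergence equation makes up for this. Both functions come from
one principle (`RectFlux.straightensAt`): let a nonvanishing continuous field `(a, b)` have
continuous divergence `K`, in the sense that its flux through small rectangles is the integral of
`K`. Then it has a `C¹` first integral `s` with `ds = f (a dy - b dx)`, `f > 0`, and `f` has
logarithmic derivative `-K` along the field.

Where `a > 0`, take coordinates `x` and `z = P x y = ∫ a x η dη` from `y₀` to `y`. The flux identity
makes `P` continuously differentiable, with `P_x = b x y₀ - b x y + ∫ K x η dη`, so the field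
becomes `a (1, R)` with `R = P_x + b`. As a function of `z` at fixed `x`, `R` has the continuous
derivative `ρ = K / a`, since `dz = a dy`. Hence `z' = R x z` has a flow that is `C¹` in its initial
value. The initial value is the first integral, and the reciprocal of the flow's derivative is `f`,
with logarithmic derivative `-ρ` in `x`, that is `-K` along the field.

The principle is applied to `N` with `K = H`, where the weak equation gives the flux identity
(`rectFlux_of_weak`), and to `(∇u + F)^⊥ = D N^⊥` with `K = rot F`, where it follows from the
fundamental theorem of calculus (`rectFlux_perp_gradient`, `rectFlux_perp`). This gives `s`, `f`
and, up to sign, `t`, `g`. The gradients of `s` and `t` are orthogonal and nonzero, so `(s, t)` is a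
local chart (`exists_chart`) whose coordinate lines, reparametrized, are the two families of curves;
orthonormality of `N^⊥`, `N` gives the metric. -/

/-- The retraction of `ℝ` onto the interval `[c - r, c + r]`. -/
def clamp (c r x : ℝ) : ℝ := max (c - r) (min (c + r) x)

@[fun_prop]
lemma continuous_clamp (c r : ℝ) : Continuous (clamp c r) := by
  unfold clamp; fun_prop

lemma clamp_mem {c r : ℝ} (hr : 0 ≤ r) (x : ℝ) : clamp c r x ∈ Icc (c - r) (c + r) := by
  unfold clamp
  exact ⟨le_max_left _ _, max_le (by linarith) (min_le_left _ _)⟩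

lemma clamp_of_mem {c r x : ℝ} (hx : x ∈ Icc (c - r) (c + r)) : clamp c r x = x := by
  unfold clamp
  rw [min_eq_right hx.2, max_eq_right hx.1]

/-! ### Scalar equations `z' = R x z`: existence and dependence on the initial value. -/

/-- Local flow of a scalar differential equation `z' = R x z` with `R` continuous and
continuously differentiable in `z`. -/
lemma exists_scalar_flow (R ρ : ℝ → ℝ → ℝ) (hR : Continuous (Function.uncurry R))
    (hρ : Continuous (Function.uncurry ρ)) (hRρ : ∀ x z, HasDerivAt (R x) (ρ x z) z)
    (x₀ z₀ : ℝ) :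
    ∃ (ε : ℝ) (Z : ℝ → ℝ → ℝ), 0 < ε ∧ Continuous (Function.uncurry Z) ∧
      (∀ η ∈ Ioo (z₀ - ε) (z₀ + ε), Z x₀ η = η) ∧
      ∀ x ∈ Ioo (x₀ - ε) (x₀ + ε), ∀ η ∈ Ioo (z₀ - ε) (z₀ + ε),
        HasDerivAt (fun x => Z x η) (R x (Z x η)) x := by
  have hcpt : IsCompact (Icc (x₀ - 1) (x₀ + 1) ×ˢ closedBall z₀ 1) :=
    isCompact_Icc.prod (isCompact_closedBall _ _)
  obtain ⟨L, hL⟩ := hcpt.exists_bound_of_continuousOn hR.continuousOn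
  obtain ⟨C, hC⟩ := hcpt.exists_bound_of_continuousOn hρ.continuousOn
  set L' : ℝ≥0 := Real.toNNReal L
  set C' : ℝ≥0 := Real.toNNReal C
  -- Solutions starting within `1/2` of `z₀` must stay within `1`, so `L' * ε ≤ 1 - 1/2` is needed;
  -- the `+ 1` avoids dividing by zero. The bound `ε ≤ 1/2` places the initial values in that
  -- smaller ball.
  set ε : ℝ := min (1 / 2) (1 / (2 * (L' + 1))) with hε
  have hε0 : 0 < ε := by positivity
  have hε1 : ε ≤ 1 / 2 := min_le_left _ _
  have hLε : L' * ε ≤ 1 / 2 := by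
    calc (L' : ℝ) * ε ≤ L' * (1 / (2 * (L' + 1))) := by gcongr; exact min_le_right _ _
      _ ≤ 1 / 2 := by
        rw [mul_one_div, div_le_div_iff₀ (by positivity) (by norm_num)]
        nlinarith [L'.2]
  have hsub : ∀ t ∈ Icc (x₀ - ε) (x₀ + ε), t ∈ Icc (x₀ - 1) (x₀ + 1) := fun t ht =>
    ⟨by linarith [ht.1], by linarith [ht.2]⟩
  have hpl : IsPicardLindelof R (tmin := x₀ - ε) (tmax := x₀ + ε)
      ⟨x₀, by constructor <;> linarith⟩ z₀ 1 (1 / 2) L' C' := by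
    refine ⟨fun t ht => ?_, fun z hz => ?_, fun t ht z hz => ?_, ?_⟩
    · refine (convex_closedBall z₀ _).lipschitzOnWith_of_nnnorm_hasDerivWithin_le
        (fun z hz => (hRρ t z).hasDerivWithinAt) fun z hz => ?_
      have := hC (t, z) ⟨hsub t ht, by simpa using hz⟩
      rw [← NNReal.coe_le_coe]
      exact this.trans (Real.le_coe_toNNReal _)
    · exact (hR.comp (by fun_prop : Continuous fun t : ℝ => (t, z))).continuousOn
    · exact (hL (t, z) ⟨hsub t ht, by simpa using hz⟩).trans (Real.le_coe_toNNReal _)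
    · have : max (x₀ + ε - x₀) (x₀ - (x₀ - ε)) = ε := by
        rw [add_sub_cancel_left, sub_sub_cancel, max_self]
      simp only [this]
      push_cast
      linarith
  obtain ⟨α, hα, hαc⟩ := hpl.exists_forall_mem_closedBall_eq_hasDerivWithinAt_continuousOn
  have hball : ∀ η ∈ Icc (z₀ - ε) (z₀ + ε), η ∈ closedBall z₀ ((1 / 2 : ℝ≥0) : ℝ) := by
    intro η hη
    rw [Real.closedBall_eq_Icc]
    push_cast
    exact ⟨by linarith [hη.1], by linarith [hη.2]⟩
  -- `α` is controlled only on a closed rectangle; clamping both arguments makes `Z` continuous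
  -- everywhere without changing it on the open square.
  refine ⟨ε, fun x η => α (clamp z₀ ε η, clamp x₀ ε x), hε0, ?_, ?_, ?_⟩
  · refine hαc.comp_continuous (f := fun q : ℝ × ℝ => (clamp z₀ ε q.2, clamp x₀ ε q.1))
      (by fun_prop) fun q => ⟨hball _ (clamp_mem hε0.le _), clamp_mem hε0.le _⟩
  · intro η hη
    dsimp only
    rw [clamp_of_mem (Ioo_subset_Icc_self hη),
      clamp_of_mem (show x₀ ∈ _ by constructor <;> linarith)]
    exact (hα η (hball _ (Ioo_subset_Icc_self hη))).1
  · intro x hx η hη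
    dsimp only
    rw [clamp_of_mem (Ioo_subset_Icc_self hη), clamp_of_mem (Ioo_subset_Icc_self hx)]
    refine (((hα η (hball _ (Ioo_subset_Icc_self hη))).2 x
      (Ioo_subset_Icc_self hx)).hasDerivAt (Icc_mem_nhds hx.1 hx.2)).congr_of_eventuallyEq ?_
    filter_upwards [Ioo_mem_nhds hx.1 hx.2] with y hy
    rw [clamp_of_mem (Ioo_subset_Icc_self hy)]

/-- The linear equation solved by the difference of two solutions of `z' = R x z`. -/
lemma scalar_flow_sub (R ρ : ℝ → ℝ → ℝ)
    (hρ : Continuous (Function.uncurry ρ)) (hRρ : ∀ x z, HasDerivAt (R x) (ρ x z) z)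
    {x₀ ε : ℝ} (hε : 0 < ε) {z₁ z₂ : ℝ → ℝ} (hc₁ : Continuous z₁) (hc₂ : Continuous z₂)
    (hz₁ : ∀ x ∈ Ioo (x₀ - ε) (x₀ + ε), HasDerivAt z₁ (R x (z₁ x)) x)
    (hz₂ : ∀ x ∈ Ioo (x₀ - ε) (x₀ + ε), HasDerivAt z₂ (R x (z₂ x)) x) :
    ∀ x ∈ Ioo (x₀ - ε) (x₀ + ε), z₂ x - z₁ x = (z₂ x₀ - z₁ x₀) *
      Real.exp (∫ ξ in x₀..x, ∫ τ in (0 : ℝ)..1, ρ ξ (z₁ ξ + τ * (z₂ ξ - z₁ ξ))) := by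
  -- Averaging `ρ` over the segment between the two solutions gives `R ξ z₂ - R ξ z₁ = q ξ * (z₂ -
  -- z₁)`. The difference thus solves a linear equation, settled by an integrating factor.
  set q : ℝ → ℝ := fun ξ => ∫ τ in (0 : ℝ)..1, ρ ξ (z₁ ξ + τ * (z₂ ξ - z₁ ξ)) with hq
  have hqc : Continuous q := by
    apply intervalIntegral.continuous_parametric_intervalIntegral_of_continuous'
    exact hρ.comp (by fun_prop : Continuous fun p : ℝ × ℝ =>
      (p.1, z₁ p.1 + p.2 * (z₂ p.1 - z₁ p.1)))
  have hqR : ∀ ξ, R ξ (z₂ ξ) - R ξ (z₁ ξ) = q ξ * (z₂ ξ - z₁ ξ) := by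
    intro ξ
    have h1 : ∀ τ ∈ uIcc (0 : ℝ) 1, HasDerivAt (fun τ => R ξ (z₁ ξ + τ * (z₂ ξ - z₁ ξ)))
        (ρ ξ (z₁ ξ + τ * (z₂ ξ - z₁ ξ)) * (z₂ ξ - z₁ ξ)) τ := by
      intro τ _
      have := ((hasDerivAt_id τ).mul_const (z₂ ξ - z₁ ξ)).const_add (z₁ ξ)
      exact ((hRρ ξ (z₁ ξ + τ * (z₂ ξ - z₁ ξ))).comp τ this).congr_deriv (by rw [one_mul])
    have h2 := intervalIntegral.integral_eq_sub_of_hasDerivAt h1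
      (Continuous.intervalIntegrable (by
        exact (hρ.comp (by fun_prop : Continuous fun τ : ℝ =>
          (ξ, z₁ ξ + τ * (z₂ ξ - z₁ ξ)))).mul continuous_const) _ _)
    rw [intervalIntegral.integral_mul_const] at h2
    rw [hq]
    simp only
    rw [h2]
    simp
  have hE : ∀ x, HasDerivAt (fun x => ∫ ξ in x₀..x, q ξ) (q x) x := fun x =>
    intervalIntegral.integral_hasDerivAt_right (hqc.intervalIntegrable _ _)
      hqc.aestronglyMeasurable.stronglyMeasurableAtFilter hqc.continuousAt
  have hd : ∀ x ∈ Ioo (x₀ - ε) (x₀ + ε),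
      HasDerivAt (fun x => (z₂ x - z₁ x) * Real.exp (-∫ ξ in x₀..x, q ξ)) 0 x := by
    intro x hx
    have := ((hz₂ x hx).sub (hz₁ x hx)).mul ((hE x).neg.exp)
    refine this.congr_deriv ?_
    rw [hqR]
    simp only [Pi.sub_apply]
    ring
  intro x hx
  have hconst := isOpen_Ioo.is_const_of_deriv_eq_zero isPreconnected_Ioo
    (fun x hx => (hd x hx).differentiableAt.differentiableWithinAt)
    (fun x hx => (hd x hx).deriv) hx (show x₀ ∈ Ioo (x₀ - ε) (x₀ + ε) by constructor <;> linarith)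
  simp only [intervalIntegral.integral_same, neg_zero, Real.exp_zero, mul_one] at hconst
  rw [← hconst, mul_assoc, ← Real.exp_add]
  simp

/-- Differentiability of the local flow with respect to the initial value. -/
lemma scalar_flow_hasDerivAt (R ρ : ℝ → ℝ → ℝ)
    (hρ : Continuous (Function.uncurry ρ)) (hRρ : ∀ x z, HasDerivAt (R x) (ρ x z) z)
    {x₀ z₀ ε : ℝ} (hε : 0 < ε) {Z : ℝ → ℝ → ℝ} (hZc : Continuous (Function.uncurry Z))
    (hZ₀ : ∀ η ∈ Ioo (z₀ - ε) (z₀ + ε), Z x₀ η = η)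
    (hZ : ∀ x ∈ Ioo (x₀ - ε) (x₀ + ε), ∀ η ∈ Ioo (z₀ - ε) (z₀ + ε),
        HasDerivAt (fun x => Z x η) (R x (Z x η)) x) :
    ∀ x ∈ Ioo (x₀ - ε) (x₀ + ε), ∀ η ∈ Ioo (z₀ - ε) (z₀ + ε),
      HasDerivAt (Z x) (Real.exp (∫ ξ in x₀..x, ρ ξ (Z ξ η))) η := by
  intro x hx η hη
  have hZ1 : ∀ η, Continuous fun x => Z x η := fun η =>
    hZc.comp (by fun_prop : Continuous fun x : ℝ => (x, η))
  -- The difference quotient of `Z x` between `η` and `η'` is exactly `e η'`, so continuity of `e`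
  -- at `η` already gives the derivative.
  set e : ℝ → ℝ := fun η' =>
    Real.exp (∫ ξ in x₀..x, ∫ τ in (0 : ℝ)..1, ρ ξ (Z ξ η + τ * (Z ξ η' - Z ξ η))) with he
  have hec : Continuous e := by
    apply Real.continuous_exp.comp
    apply intervalIntegral.continuous_parametric_intervalIntegral_of_continuous'
    change Continuous fun p : ℝ × ℝ =>
      ∫ τ in (0 : ℝ)..1, ρ p.2 (Z p.2 η + τ * (Z p.2 p.1 - Z p.2 η))
    apply intervalIntegral.continuous_parametric_intervalIntegral_of_continuous'
    have h1 : Continuous fun p : (ℝ × ℝ) × ℝ => Z p.1.2 η :=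
      (hZ1 η).comp (by fun_prop : Continuous fun p : (ℝ × ℝ) × ℝ => p.1.2)
    have h2 : Continuous fun p : (ℝ × ℝ) × ℝ => Z p.1.2 p.1.1 :=
      hZc.comp (by fun_prop : Continuous fun p : (ℝ × ℝ) × ℝ => (p.1.2, p.1.1))
    exact hρ.comp (by fun_prop : Continuous fun p : (ℝ × ℝ) × ℝ =>
      (p.1.2, Z p.1.2 η + p.2 * (Z p.1.2 p.1.1 - Z p.1.2 η)))
  have heη : e η = Real.exp (∫ ξ in x₀..x, ρ ξ (Z ξ η)) := by simp [he]
  have hsub : ∀ η' ∈ Ioo (z₀ - ε) (z₀ + ε), Z x η' - Z x η = (η' - η) * e η' := by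
    intro η' hη'
    have := scalar_flow_sub R ρ hρ hRρ hε (hZ1 η) (hZ1 η') (fun x hx => hZ x hx η hη)
      (fun x hx => hZ x hx η' hη') x hx
    rwa [hZ₀ η hη, hZ₀ η' hη'] at this
  rw [← heη, hasDerivAt_iff_tendsto_slope]
  refine ((hec.tendsto η).mono_left nhdsWithin_le_nhds).congr' ?_
  filter_upwards [self_mem_nhdsWithin, mem_nhdsWithin_of_mem_nhds (Ioo_mem_nhds hη.1 hη.2)]
    with η' hne hη'
  rw [slope_def_field, hsub η' hη', mul_div_cancel_left₀ _ (sub_ne_zero.mpr hne)]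

/-! ### First integrals of the field `(1, R)`. -/

/-- The linear automorphism `(u, v) ↦ (u, r u + e v)` of the plane. -/
def shearEquiv (r e : ℝ) (he : e ≠ 0) : (ℝ × ℝ) ≃L[ℝ] (ℝ × ℝ) :=
  ContinuousLinearEquiv.equivOfInverse
    ((ContinuousLinearMap.fst ℝ ℝ ℝ).prod
      (r • ContinuousLinearMap.fst ℝ ℝ ℝ + e • ContinuousLinearMap.snd ℝ ℝ ℝ))
    ((ContinuousLinearMap.fst ℝ ℝ ℝ).prod
      (e⁻¹ • (ContinuousLinearMap.snd ℝ ℝ ℝ - r • ContinuousLinearMap.fst ℝ ℝ ℝ)))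
    (fun p => by ext <;> simp [he]) (fun p => by ext <;> simp [he])

/-- A map `(x, y) ↦ (x, P x y)` with continuous partial derivatives is strictly differentiable. -/
lemma hasStrictFDerivAt_shear {P P₁ P₂ : ℝ → ℝ → ℝ} {p : ℝ × ℝ}
    (h₁ : ∀ᶠ q in 𝓝 p, HasDerivAt (fun x => P x q.2) (P₁ q.1 q.2) q.1)
    (h₂ : ∀ᶠ q in 𝓝 p, HasDerivAt (P q.1) (P₂ q.1 q.2) q.2)
    (c₁ : ContinuousAt (Function.uncurry P₁) p) (c₂ : ContinuousAt (Function.uncurry P₂) p) :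
    HasStrictFDerivAt (Function.uncurry P)
      (P₁ p.1 p.2 • ContinuousLinearMap.fst ℝ ℝ ℝ + P₂ p.1 p.2 • ContinuousLinearMap.snd ℝ ℝ ℝ)
      p := by
  have hcont : Continuous fun c : ℝ => ContinuousLinearMap.toSpanSingleton ℝ c :=
    (ContinuousLinearMap.toSpanSingletonCLE (𝕜 := ℝ) (E := ℝ)).continuous
  have := hasStrictFDerivAt_uncurry_coprod (𝕜 := ℝ) (u := p) (f := P)
    (f₁ := fun x y => ContinuousLinearMap.toSpanSingleton ℝ (P₁ x y))
    (f₂ := fun x y => ContinuousLinearMap.toSpanSingleton ℝ (P₂ x y))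
    (h₁.mono fun q hq => hq.hasFDerivAt) (h₂.mono fun q hq => hq.hasFDerivAt)
    (hcont.continuousAt.comp c₁) (hcont.continuousAt.comp c₂)
  refine this.congr_fderiv ?_
  ext <;> simp [Function.HasUncurry.uncurry]

/-- Straightening of the field `(1, R)`, where `R` is continuous and continuously differentiable
in the second variable: a first integral `S` with nonvanishing gradient `m (-R, 1)`, whose
density `m` obeys the transport equation along the integral curves. -/
lemma exists_first_integral (R ρ : ℝ → ℝ → ℝ) (hR : Continuous (Function.uncurry R))
    (hρ : Continuous (Function.uncurry ρ)) (hRρ : ∀ x z, HasDerivAt (R x) (ρ x z) z)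
    (x₀ z₀ : ℝ) :
    ∃ (W : Set (ℝ × ℝ)) (S m : ℝ × ℝ → ℝ), IsOpen W ∧ (x₀, z₀) ∈ W ∧ ContinuousOn m W ∧
      (∀ q ∈ W, 0 < m q) ∧
      (∀ q ∈ W, HasFDerivAt S (m q • (ContinuousLinearMap.snd ℝ ℝ ℝ -
        R q.1 q.2 • ContinuousLinearMap.fst ℝ ℝ ℝ)) q) ∧
      ∀ (I : Set ℝ) (x z c : ℝ → ℝ), IsOpen I → I.OrdConnected →
        (∀ σ ∈ I, HasDerivAt x (c σ) σ) → (∀ σ ∈ I, HasDerivAt z (c σ * R (x σ) (z σ)) σ) →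
        (∀ σ ∈ I, (x σ, z σ) ∈ W) →
        ∀ σ ∈ I, HasDerivAt (fun σ => m (x σ, z σ))
          (-(c σ * ρ (x σ) (z σ) * m (x σ, z σ))) σ := by
  obtain ⟨ε, Z, hε, hZc, hZ₀, hZ⟩ := exists_scalar_flow R ρ hR hρ hRρ x₀ z₀
  have hZη := scalar_flow_hasDerivAt R ρ hρ hRρ hε hZc hZ₀ hZ
  have hρZ : ∀ η, Continuous fun ξ => ρ ξ (Z ξ η) := fun η =>
    hρ.comp (continuous_id.prodMk (hZc.comp (by fun_prop : Continuous fun x : ℝ => (x, η))))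
  set E : ℝ → ℝ → ℝ := fun x η => Real.exp (∫ ξ in x₀..x, ρ ξ (Z ξ η)) with hE
  have hEc : Continuous (Function.uncurry E) := by
    apply Real.continuous_exp.comp
    apply intervalIntegral.continuous_parametric_intervalIntegral_of_continuous
      (f := fun (p : ℝ × ℝ) ξ => ρ ξ (Z ξ p.2)) _ continuous_fst
    exact hρ.comp (continuous_snd.prodMk
      (hZc.comp (by fun_prop : Continuous fun x : (ℝ × ℝ) × ℝ => (x.2, x.1.2))))
  have hEpos : ∀ x η, 0 < E x η := fun x η => Real.exp_pos _
  set B : Set (ℝ × ℝ) := Ioo (x₀ - ε) (x₀ + ε) ×ˢ Ioo (z₀ - ε) (z₀ + ε) with hB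
  have hBo : IsOpen B := isOpen_Ioo.prod isOpen_Ioo
  have hB₀ : (x₀, z₀) ∈ B := by
    refine ⟨?_, ?_⟩ <;> constructor <;> simp only <;> linarith
  -- `T` sends a position and an initial value to the point reached there. The second component of
  -- its local inverse recovers the initial value, which is the first integral sought.
  set T : ℝ × ℝ → ℝ × ℝ := fun p => (p.1, Z p.1 p.2) with hT
  have hTd : ∀ p ∈ B, HasStrictFDerivAt T
      (shearEquiv (R p.1 (Z p.1 p.2)) (E p.1 p.2) (hEpos _ _).ne' :
        (ℝ × ℝ) →L[ℝ] (ℝ × ℝ)) p := by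
    intro p hp
    have h1 := hasStrictFDerivAt_shear (P := Z) (P₁ := fun x η => R x (Z x η)) (P₂ := E) (p := p)
      (by filter_upwards [hBo.mem_nhds hp] with q hq using hZ q.1 hq.1 q.2 hq.2)
      (by filter_upwards [hBo.mem_nhds hp] with q hq using hZη q.1 hq.1 q.2 hq.2)
      (hR.comp (continuous_fst.prodMk hZc)).continuousAt hEc.continuousAt
    exact hasStrictFDerivAt_fst.prodMk h1
  set e := (hTd _ hB₀).toOpenPartialHomeomorph T with he
  have hecoe : (e : ℝ × ℝ → ℝ × ℝ) = T := rfl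
  set W : Set (ℝ × ℝ) := e.target ∩ e.symm ⁻¹' B with hW
  have hWo : IsOpen W := e.isOpen_inter_preimage_symm hBo
  have hT₀ : T (x₀, z₀) = (x₀, z₀) := by
    simp only [hT]
    rw [hZ₀ z₀ hB₀.2]
  have hsrc : (x₀, z₀) ∈ e.source := (hTd _ hB₀).mem_toOpenPartialHomeomorph_source
  have hW₀ : (x₀, z₀) ∈ W := by
    have h1 := e.map_source hsrc
    have h2 := e.left_inv hsrc
    rw [hecoe, hT₀] at h1 h2
    exact ⟨h1, by rw [mem_preimage, h2]; exact hB₀⟩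
  have hinv : ∀ q ∈ W, (e.symm q).1 = q.1 ∧ Z q.1 (e.symm q).2 = q.2 := by
    intro q hq
    have h0 : T (e.symm q) = q := e.right_inv hq.1
    have h1 : (T (e.symm q)).1 = q.1 := by rw [h0]
    have h2 : (T (e.symm q)).2 = q.2 := by rw [h0]
    have h3 : (e.symm q).1 = q.1 := h1
    refine ⟨h3, ?_⟩
    rw [← h3]
    exact h2
  have hS : ∀ q ∈ W, HasFDerivAt (fun q => (e.symm q).2) ((E q.1 (e.symm q).2)⁻¹ •
      (ContinuousLinearMap.snd ℝ ℝ ℝ - R q.1 q.2 • ContinuousLinearMap.fst ℝ ℝ ℝ)) q := by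
    intro q hq
    have h1 := e.hasFDerivAt_symm hq.1 (hTd _ hq.2).hasFDerivAt
    refine (hasFDerivAt_snd.comp q h1).congr_fderiv ?_
    ext <;> simp [shearEquiv, (hinv q hq).1, (hinv q hq).2]
  refine ⟨W, fun q => (e.symm q).2, fun q => (E q.1 (e.symm q).2)⁻¹, hWo, hW₀, ?_, ?_, hS, ?_⟩
  · have h1 : ContinuousOn (fun q => (e.symm q).2) W :=
      continuous_snd.comp_continuousOn (e.symm.continuousOn.mono inter_subset_left)
    exact (hEc.comp_continuousOn (continuousOn_fst.prodMk h1)).inv₀ fun q _ => (hEpos _ _).ne'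
  · exact fun q _ => inv_pos.mpr (hEpos _ _)
  · intro I x z c hIo hIc hx hz hxz σ hσ
    -- The density is only continuous as a function of two variables. Along the curve, however, the
    -- initial value is constant, so the density is read off one fixed solution, where it is the
    -- exponential of a differentiable integral.
    have hconst : ∀ τ ∈ I, (e.symm (x τ, z τ)).2 = (e.symm (x σ, z σ)).2 := by
      have hd : ∀ τ ∈ I, HasDerivAt (fun τ => (e.symm (x τ, z τ)).2) 0 τ := by
        intro τ hτ
        refine ((hS _ (hxz τ hτ)).comp_hasDerivAt τ ((hx τ hτ).prodMk (hz τ hτ))).congr_deriv ?_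
        simp only [_root_.smul_apply, _root_.sub_apply,
          ContinuousLinearMap.coe_snd', ContinuousLinearMap.coe_fst', smul_eq_mul]
        ring
      intro τ hτ
      exact hIo.is_const_of_deriv_eq_zero hIc.isPreconnected
        (fun x hx => (hd x hx).differentiableAt.differentiableWithinAt)
        (fun x hx => (hd x hx).deriv) hτ hσ
    set η := (e.symm (x σ, z σ)).2 with hη
    have hF : HasDerivAt (fun y => ∫ ξ in x₀..y, ρ ξ (Z ξ η)) (ρ (x σ) (Z (x σ) η)) (x σ) :=
      intervalIntegral.integral_hasDerivAt_right ((hρZ η).intervalIntegrable _ _)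
        (hρZ η).aestronglyMeasurable.stronglyMeasurableAtFilter (hρZ η).continuousAt
    have hG := (hF.comp σ (hx σ hσ)).neg.exp
    have hZσ : Z (x σ) η = z σ := (hinv _ (hxz σ hσ)).2
    have hexp : ∀ τ, (E (x τ) η)⁻¹ =
        Real.exp ((-((fun y => ∫ ξ in x₀..y, ρ ξ (Z ξ η)) ∘ x)) τ) := by
      intro τ
      simp [hE, Real.exp_neg]
    refine (hG.congr_of_eventuallyEq (f₁ := fun σ => (E (x σ) (e.symm (x σ, z σ)).2)⁻¹) ?_).congr_deriv ?_
    · filter_upwards [hIo.mem_nhds hσ] with τ hτ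
      rw [hconst τ hτ, hexp]
    · rw [← hexp, hZσ]
      ring

/-! ### Straightening a continuous field that satisfies the flux identity. -/

/-- The flux of `(a, b)` through the boundary of each rectangle in the open square of radius `r`
about `(x₀, y₀)` is the integral of `K`. -/
def RectFlux (a b K : ℝ → ℝ → ℝ) (x₀ y₀ r : ℝ) : Prop :=
  ∀ x₁ ∈ Ioo (x₀ - r) (x₀ + r), ∀ x₂ ∈ Ioo (x₀ - r) (x₀ + r),
  ∀ y₁ ∈ Ioo (y₀ - r) (y₀ + r), ∀ y₂ ∈ Ioo (y₀ - r) (y₀ + r),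
    (∫ y in y₁..y₂, (a x₂ y - a x₁ y)) + (∫ x in x₁..x₂, (b x y₂ - b x y₁)) =
      ∫ x in x₁..x₂, ∫ y in y₁..y₂, K x y

/-- Near `(x₀, y₀)` there are a first integral `s` of the field `(a, b)` and a positive `f` with
`ds = f (a dy - b dx)`, such that `f` has logarithmic derivative `-K` along `(a, b)`. -/
def StraightensAt (a b K : ℝ → ℝ → ℝ) (x₀ y₀ : ℝ) : Prop :=
  ∃ (U : Set (ℝ × ℝ)) (s f : ℝ × ℝ → ℝ), IsOpen U ∧ (x₀, y₀) ∈ U ∧ ContinuousOn f U ∧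
    (∀ q ∈ U, 0 < f q) ∧
    (∀ q ∈ U, HasFDerivAt s (f q • (a q.1 q.2 • ContinuousLinearMap.snd ℝ ℝ ℝ -
      b q.1 q.2 • ContinuousLinearMap.fst ℝ ℝ ℝ)) q) ∧
    ∀ (I : Set ℝ) (x y c : ℝ → ℝ), IsOpen I → I.OrdConnected →
      (∀ σ ∈ I, HasDerivAt x (c σ * a (x σ) (y σ)) σ) →
      (∀ σ ∈ I, HasDerivAt y (c σ * b (x σ) (y σ)) σ) →
      (∀ σ ∈ I, (x σ, y σ) ∈ U) →
      ∀ σ ∈ I, HasDerivAt (fun σ => f (x σ, y σ))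
        (-(c σ * K (x σ) (y σ) * f (x σ, y σ))) σ

lemma exists_square_subset {A : Set (ℝ × ℝ)} {x y : ℝ} (hA : A ∈ 𝓝 (x, y)) :
    ∃ r > 0, Icc (x - r) (x + r) ×ˢ Icc (y - r) (y + r) ⊆ A := by
  obtain ⟨r, hr, h⟩ := Metric.nhds_basis_closedBall.mem_iff.mp hA
  refine ⟨r, hr, ?_⟩
  rwa [← closedBall_prod_same, Real.closedBall_eq_Icc, Real.closedBall_eq_Icc] at h

/-- The flux identity makes `x ↦ ∫_{y₀}^y a x η dη` differentiable. -/
lemma RectFlux.hasDerivAt {a b K : ℝ → ℝ → ℝ} {x₀ y₀ r : ℝ}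
    (ha : Continuous (Function.uncurry a)) (hb : Continuous (Function.uncurry b))
    (hK : Continuous (Function.uncurry K)) (h : RectFlux a b K x₀ y₀ r) (hr : 0 < r)
    {x y : ℝ} (hx : x ∈ Ioo (x₀ - r) (x₀ + r)) (hy : y ∈ Ioo (y₀ - r) (y₀ + r)) :
    HasDerivAt (fun x => ∫ η in y₀..y, a x η) (b x y₀ - b x y + ∫ η in y₀..y, K x η) x := by
  have hby : ∀ y, Continuous fun x => b x y := fun y =>
    hb.comp (by fun_prop : Continuous fun x : ℝ => (x, y))
  have hax : ∀ x, Continuous (a x) := fun x =>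
    ha.comp (by fun_prop : Continuous fun y : ℝ => (x, y))
  have hKc : Continuous fun x => ∫ η in y₀..y, K x η :=
    intervalIntegral.continuous_parametric_intervalIntegral_of_continuous' hK _ _
  set g : ℝ → ℝ := fun x => b x y₀ - b x y + ∫ η in y₀..y, K x η with hg
  have hgc : Continuous g := ((hby _).sub (hby _)).add hKc
  -- This is the flux identity on the rectangle between `x`, `x'` and `y₀`, `y`, solved for the
  -- difference of the two vertical sides.
  have key : ∀ x' ∈ Ioo (x₀ - r) (x₀ + r),
      ∫ η in y₀..y, a x' η = (∫ η in y₀..y, a x η) + ∫ ξ in x..x', g ξ := by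
    intro x' hx'
    have h1 := h x hx x' hx' y₀ (by constructor <;> linarith) y hy
    rw [intervalIntegral.integral_sub ((hax _).intervalIntegrable _ _)
      ((hax _).intervalIntegrable _ _), intervalIntegral.integral_sub
      ((hby _).intervalIntegrable _ _) ((hby _).intervalIntegrable _ _)] at h1
    have h2 : ∫ ξ in x..x', g ξ = (∫ ξ in x..x', (b ξ y₀ - b ξ y)) +
        ∫ ξ in x..x', ∫ η in y₀..y, K ξ η :=
      intervalIntegral.integral_add (((hby _).sub (hby _)).intervalIntegrable _ _)
        (hKc.intervalIntegrable _ _)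
    rw [intervalIntegral.integral_sub ((hby _).intervalIntegrable _ _)
      ((hby _).intervalIntegrable _ _)] at h2
    linarith
  have h2 : HasDerivAt (fun x' => ∫ ξ in x..x', g ξ) (g x) x :=
    intervalIntegral.integral_hasDerivAt_right (hgc.intervalIntegrable _ _)
      hgc.aestronglyMeasurable.stronglyMeasurableAtFilter hgc.continuousAt
  refine (h2.const_add (∫ η in y₀..y, a x η)).congr_of_eventuallyEq ?_
  filter_upwards [Ioo_mem_nhds hx.1 hx.2] with x' hx'
  exact key x' hx'

/-- The change of variables `Q = (x, P)` turns the field into `a (1, R)`, with `R` differentiable in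
its second argument although `a` and `b` are merely continuous. The first integral of `(1, R)` is
then pulled back by `Q`. -/
lemma RectFlux.straightensAt_of_pos {a b K : ℝ → ℝ → ℝ} {x₀ y₀ r : ℝ}
    (ha : Continuous (Function.uncurry a)) (hb : Continuous (Function.uncurry b))
    (hK : Continuous (Function.uncurry K)) (h : RectFlux a b K x₀ y₀ r) (hr : 0 < r)
    (hpos : 0 < a x₀ y₀) : StraightensAt a b K x₀ y₀ := by
  have hax : ∀ x, Continuous (a x) := fun x =>
    ha.comp (by fun_prop : Continuous fun y : ℝ => (x, y))
  set P : ℝ → ℝ → ℝ := fun x y => ∫ η in y₀..y, a x η with hP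
  set P₁ : ℝ → ℝ → ℝ := fun x y => b x y₀ - b x y + ∫ η in y₀..y, K x η with hP₁
  have hP₁c : Continuous (Function.uncurry P₁) := by
    refine Continuous.add (Continuous.sub (hb.comp (by fun_prop :
      Continuous fun p : ℝ × ℝ => (p.1, y₀))) hb) ?_
    exact intervalIntegral.continuous_parametric_primitive_of_continuous hK
  have hPc : Continuous (Function.uncurry P) :=
    intervalIntegral.continuous_parametric_primitive_of_continuous ha
  set B : Set (ℝ × ℝ) := Ioo (x₀ - r) (x₀ + r) ×ˢ Ioo (y₀ - r) (y₀ + r) with hB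
  have hBo : IsOpen B := isOpen_Ioo.prod isOpen_Ioo
  have hB₀ : (x₀, y₀) ∈ B := by
    refine ⟨?_, ?_⟩ <;> constructor <;> simp only <;> linarith
  have hPy : ∀ x y, HasDerivAt (P x) (a x y) y := fun x y =>
    intervalIntegral.integral_hasDerivAt_right ((hax x).intervalIntegrable _ _)
      (hax x).aestronglyMeasurable.stronglyMeasurableAtFilter (hax x).continuousAt
  have hPd : ∀ p ∈ B, HasStrictFDerivAt (Function.uncurry P)
      (P₁ p.1 p.2 • ContinuousLinearMap.fst ℝ ℝ ℝ + a p.1 p.2 • ContinuousLinearMap.snd ℝ ℝ ℝ)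
      p := by
    intro p hp
    refine hasStrictFDerivAt_shear ?_ (Eventually.of_forall fun q => hPy q.1 q.2)
      hP₁c.continuousAt ha.continuousAt
    filter_upwards [hBo.mem_nhds hp] with q hq using h.hasDerivAt ha hb hK hr hq.1 hq.2
  set Q : ℝ × ℝ → ℝ × ℝ := fun p => (p.1, P p.1 p.2) with hQ
  have hQc : Continuous Q := continuous_fst.prodMk hPc
  have hQ₀ : Q (x₀, y₀) = (x₀, 0) := by simp [hQ, hP]
  have hQd : HasStrictFDerivAt Q
      (shearEquiv (P₁ x₀ y₀) (a x₀ y₀) hpos.ne' : (ℝ × ℝ) →L[ℝ] (ℝ × ℝ)) (x₀, y₀) :=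
    hasStrictFDerivAt_fst.prodMk (hPd _ hB₀)
  set e := hQd.toOpenPartialHomeomorph Q with he
  have hsrc : (x₀, y₀) ∈ e.source := hQd.mem_toOpenPartialHomeomorph_source
  set A : Set (ℝ × ℝ) := {q | 0 < a q.1 q.2} with hA
  have hAo : IsOpen A := isOpen_lt continuous_const ha
  have hA₀ : e.target ∩ e.symm ⁻¹' A ∈ 𝓝 ((x₀, 0) : ℝ × ℝ) := by
    refine (e.isOpen_inter_preimage_symm hAo).mem_nhds ?_
    rw [← hQ₀]
    have h1 : e.symm (Q (x₀, y₀)) = (x₀, y₀) := e.left_inv hsrc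
    exact ⟨e.map_source hsrc, by rw [mem_preimage, h1]; exact hpos⟩
  obtain ⟨r', hr', hsub⟩ := exists_square_subset hA₀
  set k : ℝ × ℝ → ℝ := fun q => K (e.symm q).1 (e.symm q).2 / a (e.symm q).1 (e.symm q).2 with hk
  have hkc : ContinuousOn k (e.target ∩ e.symm ⁻¹' A) := by
    have h1 : ContinuousOn e.symm (e.target ∩ e.symm ⁻¹' A) :=
      e.symm.continuousOn.mono inter_subset_left
    exact (hK.comp_continuousOn h1).div (ha.comp_continuousOn h1) fun q hq => (ne_of_gt hq.2)
  -- The quotient `K / a`, written in the new coordinates, is continuous only near `(x₀, 0)`;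
  -- clamping extends it to the plane, as `exists_first_integral` requires.
  set ρ : ℝ → ℝ → ℝ := fun x z => k (clamp x₀ r' x, clamp 0 r' z) with hρ
  have hρc : Continuous (Function.uncurry ρ) :=
    hkc.comp_continuous (f := fun q : ℝ × ℝ => (clamp x₀ r' q.1, clamp 0 r' q.2)) (by fun_prop)
      fun q => hsub ⟨clamp_mem hr'.le _, clamp_mem hr'.le _⟩
  set R : ℝ → ℝ → ℝ := fun x z => b x y₀ + ∫ ζ in (0 : ℝ)..z, ρ x ζ with hR
  have hRc : Continuous (Function.uncurry R) :=
    (hb.comp (by fun_prop : Continuous fun p : ℝ × ℝ => (p.1, y₀))).add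
      (intervalIntegral.continuous_parametric_primitive_of_continuous hρc)
  have hρx : ∀ x, Continuous (ρ x) := fun x =>
    hρc.comp (by fun_prop : Continuous fun y : ℝ => (x, y))
  have hRρ : ∀ x z, HasDerivAt (R x) (ρ x z) z := fun x z =>
    (intervalIntegral.integral_hasDerivAt_right ((hρx x).intervalIntegrable _ _)
      (hρx x).aestronglyMeasurable.stronglyMeasurableAtFilter (hρx x).continuousAt).const_add _
  obtain ⟨W, S, m, hWo, hW₀, hmc, hmpos, hS, hcurve⟩ :=
    exists_first_integral R ρ hRc hρc hRρ x₀ 0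
  set G : Set (ℝ × ℝ) := Q ⁻¹' (W ∩ Ioo (x₀ - r') (x₀ + r') ×ˢ Ioo (0 - r') (0 + r')) ∩
    (e.source ∩ A ∩ B) with hG
  have hGo : IsOpen G :=
    ((hWo.inter (isOpen_Ioo.prod isOpen_Ioo)).preimage hQc).inter
      ((e.open_source.inter hAo).inter hBo)
  have hG₀ : (x₀, y₀) ∈ G := by
    refine ⟨?_, ⟨hsrc, hpos⟩, hB₀⟩
    rw [mem_preimage, hQ₀]
    refine ⟨hW₀, ?_, ?_⟩ <;> constructor <;> simp only <;> linarith
  obtain ⟨δ, hδ, hδG⟩ := exists_square_subset (hGo.mem_nhds hG₀)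
  -- A square, so that with each point it contains the vertical segment down or up to height `y₀`,
  -- along which `hRQ` integrates.
  set U : Set (ℝ × ℝ) := Ioo (x₀ - δ) (x₀ + δ) ×ˢ Ioo (y₀ - δ) (y₀ + δ) with hU
  have hUG : U ⊆ G :=
    (Set.prod_mono Ioo_subset_Icc_self Ioo_subset_Icc_self).trans hδG
  have hρQ : ∀ q ∈ G, ρ q.1 (P q.1 q.2) = K q.1 q.2 / a q.1 q.2 := by
    intro q hq
    have h1 : e.symm (Q q) = q := e.left_inv hq.2.1.1
    have h2 : (clamp x₀ r' q.1, clamp 0 r' (P q.1 q.2)) = Q q := by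
      rw [clamp_of_mem (Ioo_subset_Icc_self hq.1.2.1), clamp_of_mem (Ioo_subset_Icc_self hq.1.2.2)]
    simp only [hρ, h2, hk, h1]
  have hRQ : ∀ q ∈ U, R q.1 (P q.1 q.2) = P₁ q.1 q.2 + b q.1 q.2 := by
    intro q hq
    have h1 : ∀ η ∈ uIcc y₀ q.2, (ρ q.1 ∘ P q.1) η * a q.1 η = K q.1 η := by
      intro η hη
      have h2 : (q.1, η) ∈ U := by
        refine ⟨hq.1, ?_⟩
        exact ordConnected_Ioo.uIcc_subset (by constructor <;> linarith) hq.2 hη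
      have h3 := hρQ _ (hUG h2)
      have h4 : 0 < a q.1 η := (hUG h2).2.1.2
      simp only [Function.comp] at h3 ⊢
      rw [h3, div_mul_cancel₀ _ h4.ne']
    -- Substituting `ζ = P x η`, `dζ = a x η dη`, turns the integral of `K` into that of `ρ`.
    have h5 := intervalIntegral.integral_comp_mul_deriv (a := y₀) (b := q.2)
      (fun η _ => hPy q.1 η) (hax q.1).continuousOn (hρx q.1)
    rw [intervalIntegral.integral_congr h1] at h5
    have h6 : P q.1 y₀ = 0 := by simp [hP]
    rw [h6] at h5
    simp only [hR, hP₁, ← h5]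
    ring
  refine ⟨U, fun q => S (Q q), fun q => m (Q q), isOpen_Ioo.prod isOpen_Ioo, ?_, ?_, ?_, ?_, ?_⟩
  · refine ⟨?_, ?_⟩ <;> constructor <;> simp only <;> linarith
  · exact hmc.comp hQc.continuousOn fun q hq => (hUG hq).1.1
  · exact fun q hq => hmpos _ (hUG hq).1.1
  -- The form `m (dz - R dx)` pulls back to `m (P₁ dx + a dy - R dx)`, which is `m (a dy - b dx)`
  -- because `R = P₁ + b`.
  · intro q hq
    have h1 : HasFDerivAt Q _ q := hasFDerivAt_fst.prodMk (hPd q (hUG hq).2.2).hasFDerivAt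
    refine ((hS _ (hUG hq).1.1).comp q h1).congr_fderiv ?_
    have h2 := hRQ q hq
    ext
    · simp [hQ, h2]
    · simp [hQ]
  · intro I x y c hIo hIc hx hy hxy σ hσ
    have hz : ∀ σ ∈ I, HasDerivAt (fun σ => P (x σ) (y σ))
        (c σ * a (x σ) (y σ) * R (x σ) (P (x σ) (y σ))) σ := by
      intro τ hτ
      refine ((hPd _ (hUG (hxy τ hτ)).2.2).hasFDerivAt.comp_hasDerivAt τ
        ((hx τ hτ).prodMk (hy τ hτ))).congr_deriv ?_
      rw [hRQ _ (hxy τ hτ)]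
      simp only [_root_.smul_apply, _root_.add_apply,
        ContinuousLinearMap.coe_snd', ContinuousLinearMap.coe_fst', smul_eq_mul]
      ring
    refine (hcurve I x (fun σ => P (x σ) (y σ)) (fun σ => c σ * a (x σ) (y σ)) hIo hIc hx hz
      (fun σ hσ => (hUG (hxy σ hσ)).1.1) σ hσ).congr_deriv ?_
    rw [hρQ _ (hUG (hxy σ hσ))]
    have h4 : 0 < a (x σ) (y σ) := (hUG (hxy σ hσ)).2.1.2
    simp only [hQ]
    field_simp

lemma RectFlux.neg {a b K : ℝ → ℝ → ℝ} {x₀ y₀ r : ℝ} (h : RectFlux a b K x₀ y₀ r) :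
    RectFlux (fun x y => -a x y) (fun x y => -b x y) (fun x y => -K x y) x₀ y₀ r := by
  intro x₁ h1 x₂ h2 y₁ h3 y₂ h4
  have := h x₁ h1 x₂ h2 y₁ h3 y₂ h4
  simp only [intervalIntegral.integral_neg, ← neg_sub']
  linarith

lemma RectFlux.swap {a b K : ℝ → ℝ → ℝ} {x₀ y₀ r : ℝ} (hK : Continuous (Function.uncurry K))
    (h : RectFlux a b K x₀ y₀ r) :
    RectFlux (fun x y => b y x) (fun x y => a y x) (fun x y => K y x) y₀ x₀ r := by
  intro x₁ h1 x₂ h2 y₁ h3 y₂ h4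
  have := h y₁ h3 y₂ h4 x₁ h1 x₂ h2
  rw [add_comm, this]
  refine intervalIntegral_intervalIntegral_swap ?_
  exact (hK.continuousOn.integrableOn_compact
    (isCompact_uIcc.prod isCompact_uIcc)).mono_set (Set.prod_mono uIoc_subset_uIcc uIoc_subset_uIcc)

/-- Reversing the field changes the sign of `s` and leaves `f` alone; the arbitrary velocity factor
`c` in `StraightensAt` absorbs the sign. -/
lemma StraightensAt.of_neg {a b K : ℝ → ℝ → ℝ} {x₀ y₀ : ℝ}
    (h : StraightensAt (fun x y => -a x y) (fun x y => -b x y) (fun x y => -K x y) x₀ y₀) :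
    StraightensAt a b K x₀ y₀ := by
  obtain ⟨U, s, f, hU, hp, hf, hpos, hs, hc⟩ := h
  refine ⟨U, fun q => -s q, f, hU, hp, hf, hpos, fun q hq => ?_, ?_⟩
  · refine (hs q hq).neg.congr_fderiv ?_
    ext <;> simp
  · intro I x y c hIo hIc hx hy hxy σ hσ
    refine (hc I x y (fun σ => -c σ) hIo hIc (fun σ hσ => (hx σ hσ).congr_deriv (by ring))
      (fun σ hσ => (hy σ hσ).congr_deriv (by ring)) hxy σ hσ).congr_deriv (by ring)

/-- Exchanging the coordinates reverses orientation, hence the sign of `a dy - b dx` and of `s`. -/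
lemma StraightensAt.of_swap {a b K : ℝ → ℝ → ℝ} {x₀ y₀ : ℝ}
    (h : StraightensAt (fun x y => b y x) (fun x y => a y x) (fun x y => K y x) y₀ x₀) :
    StraightensAt a b K x₀ y₀ := by
  obtain ⟨U, s, f, hU, hp, hf, hpos, hs, hc⟩ := h
  refine ⟨Prod.swap ⁻¹' U, fun q => -s q.swap, fun q => f q.swap, hU.preimage continuous_swap, hp,
    hf.comp continuous_swap.continuousOn fun q hq => hq, fun q hq => hpos _ hq,
    fun q hq => ?_, ?_⟩
  · have h1 : HasFDerivAt (Prod.swap : ℝ × ℝ → ℝ × ℝ)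
      ((ContinuousLinearMap.snd ℝ ℝ ℝ).prod (ContinuousLinearMap.fst ℝ ℝ ℝ)) q :=
      hasFDerivAt_snd.prodMk hasFDerivAt_fst
    refine ((hs q.swap hq).comp q h1).neg.congr_fderiv ?_
    ext <;> simp
  · intro I x y c hIo hIc hx hy hxy σ hσ
    exact hc I y x c hIo hIc hy hx hxy σ hσ

/-- Sign change and exchange of coordinates reduce every nonvanishing field to the case `a > 0`. -/
lemma RectFlux.straightensAt {a b K : ℝ → ℝ → ℝ} {x₀ y₀ r : ℝ}
    (ha : Continuous (Function.uncurry a)) (hb : Continuous (Function.uncurry b))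
    (hK : Continuous (Function.uncurry K)) (h : RectFlux a b K x₀ y₀ r) (hr : 0 < r)
    (hne : a x₀ y₀ ≠ 0 ∨ b x₀ y₀ ≠ 0) : StraightensAt a b K x₀ y₀ := by
  have aux : ∀ {a b K : ℝ → ℝ → ℝ} {x₀ y₀ : ℝ}, Continuous (Function.uncurry a) →
      Continuous (Function.uncurry b) → Continuous (Function.uncurry K) →
      RectFlux a b K x₀ y₀ r → a x₀ y₀ ≠ 0 → StraightensAt a b K x₀ y₀ := by
    intro a b K x₀ y₀ ha hb hK h hne
    rcases hne.lt_or_gt with hlt | hgt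
    · exact (h.neg.straightensAt_of_pos (by exact ha.neg) (by exact hb.neg) (by exact hK.neg) hr
        (neg_pos.mpr hlt)).of_neg
    · exact h.straightensAt_of_pos ha hb hK hr hgt
  rcases hne with hne | hne
  · exact aux ha hb hK h hne
  · exact (aux (a := fun x y => b y x) (b := fun x y => a y x) (K := fun x y => K y x)
      (hb.comp continuous_swap) (ha.comp continuous_swap) (hK.comp continuous_swap)
      (h.swap hK) hne).of_swap

/-! ### From the weak divergence equation to the flux identity. -/

lemma exists_primitive_compactSupport {w : ℝ → ℝ} {c d : ℝ} (hw : ContDiff ℝ ∞ w)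
    {k₁ k₂ : ℝ} (hsupp : Function.support w ⊆ Icc k₁ k₂) (hk₁ : c < k₁) (hk₂ : k₂ < d)
    (hint : ∫ x, w x = 0) :
    ∃ φ : ℝ → ℝ, ContDiff ℝ ∞ φ ∧ HasCompactSupport φ ∧ tsupport φ ⊆ Ioo c d ∧ deriv φ = w := by
  have hwz : ∀ x, x ∉ Icc k₁ k₂ → w x = 0 := fun x hx => by
    by_contra h
    exact hx (hsupp h)
  have hd : ∀ x, HasDerivAt (fun x => ∫ ξ in (k₁ - 1)..x, w ξ) (w x) x := fun x =>
    intervalIntegral.integral_hasDerivAt_right (hw.continuous.intervalIntegrable _ _)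
      hw.continuous.aestronglyMeasurable.stronglyMeasurableAtFilter hw.continuous.continuousAt
  have hderiv : deriv (fun x => ∫ ξ in (k₁ - 1)..x, w ξ) = w := funext fun x => (hd x).deriv
  have hs : Function.support (fun x => ∫ ξ in (k₁ - 1)..x, w ξ) ⊆ Icc k₁ k₂ := by
    intro x hx
    by_contra hxk
    apply hx
    rcases lt_or_ge x k₁ with h1 | h1
    · have : ∀ ξ ∈ uIcc (k₁ - 1) x, w ξ = 0 := by
        intro ξ hξ
        apply hwz
        intro h
        have := hξ.2
        have h2 : max (k₁ - 1) x < k₁ := max_lt (by linarith) h1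
        linarith [h.1]
      simp only
      rw [intervalIntegral.integral_congr this]
      simp
    · have h2 : k₂ < x := by
        by_contra h
        exact hxk ⟨h1, not_lt.mp h⟩
      simp only
      rw [intervalIntegral.integral_eq_integral_of_support_subset, hint]
      exact hsupp.trans fun y hy => ⟨by linarith [hy.1], by linarith [hy.2]⟩
  refine ⟨_, ?_, HasCompactSupport.of_support_subset_isCompact isCompact_Icc hs, ?_, hderiv⟩
  · rw [contDiff_infty_iff_deriv, hderiv]
    exact ⟨fun x => (hd x).differentiableAt, hw⟩
  · exact (closure_minimal hs isClosed_Icc).trans fun y hy =>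
      ⟨by linarith [hy.1], by linarith [hy.2]⟩

lemma exists_Icc_of_isCompact {K : Set ℝ} {c d : ℝ} (hK : IsCompact K) (hcd : c < d)
    (hsub : K ⊆ Ioo c d) : ∃ k₁ k₂, K ⊆ Icc k₁ k₂ ∧ c < k₁ ∧ k₂ < d := by
  rcases K.eq_empty_or_nonempty with rfl | hne
  · exact ⟨(c + d) / 2, (c + d) / 2, empty_subset _, by linarith, by linarith⟩
  · exact ⟨sInf K, sSup K, fun x hx => ⟨csInf_le hK.bddBelow hx, le_csSup hK.bddAbove hx⟩,
      (hsub (hK.sInf_mem hne)).1, (hsub (hK.sSup_mem hne)).2⟩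

/-- **Du Bois-Reymond lemma**: a continuous function with zero weak derivative is constant. -/
lemma eq_of_weak_deriv_eq_zero {D : ℝ → ℝ} {c d : ℝ} (hD : Continuous D)
    (h : ∀ φ : ℝ → ℝ, ContDiff ℝ ∞ φ → HasCompactSupport φ → tsupport φ ⊆ Ioo c d →
      ∫ x, D x * deriv φ x = 0) :
    ∀ x₁ ∈ Ioo c d, ∀ x₂ ∈ Ioo c d, D x₁ = D x₂ := by
  intro x₁ hx₁ x₂ hx₂
  have hcd : c < d := hx₁.1.trans hx₁.2
  let bump : ContDiffBump ((c + d) / 2) :=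
    ⟨(d - c) / 8, (d - c) / 4, by linarith, by linarith⟩
  set w₀ : ℝ → ℝ := bump.normed volume with hw₀
  have hw₀d : ContDiff ℝ ∞ w₀ := bump.contDiff_normed
  have hw₀s : HasCompactSupport w₀ := bump.hasCompactSupport_normed
  have hw₀i : ∫ x, w₀ x = 1 := bump.integral_normed
  have hw₀t : tsupport w₀ ⊆ Ioo c d := by
    rw [hw₀, bump.tsupport_normed_eq, Real.closedBall_eq_Icc]
    intro x hx
    have h1 : (c + d) / 2 - (d - c) / 4 ≤ x := hx.1
    have h2 : x ≤ (c + d) / 2 + (d - c) / 4 := hx.2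
    constructor <;> linarith
  set m : ℝ := ∫ x, D x * w₀ x with hm
  have hint : ∀ {w : ℝ → ℝ}, ContDiff ℝ ∞ w → HasCompactSupport w →
      Integrable (fun x => D x * w x) := fun hw hs =>
    (hD.mul hw.continuous).integrable_of_hasCompactSupport hs.mul_left
  have key : ∀ w : ℝ → ℝ, ContDiff ℝ ∞ w → HasCompactSupport w → tsupport w ⊆ Ioo c d →
      ∫ x, w x • (D x - m) = 0 := by
    intro w hw hws hwt
    -- Subtracting `t * w₀` gives `w` mean zero, hence a compactly supported primitive, which is an
    -- admissible test function. So `D - m` annihilates every `w`.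
    set t : ℝ := ∫ x, w x with ht
    obtain ⟨k₁, k₂, hk, hk₁, hk₂⟩ := exists_Icc_of_isCompact
      (hws.isCompact.union hw₀s.isCompact) hcd (union_subset hwt hw₀t)
    obtain ⟨φ, hφ, hφs, hφt, hφd⟩ := exists_primitive_compactSupport
      (w := fun x => w x - t * w₀ x) (c := c) (d := d)
      (hw.sub (contDiff_const.mul hw₀d)) (k₁ := k₁) (k₂ := k₂) (by
        intro x hx
        apply hk
        by_contra hxu
        rw [mem_union, not_or] at hxu
        apply hx
        simp [image_eq_zero_of_notMem_tsupport hxu.1, image_eq_zero_of_notMem_tsupport hxu.2])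
      hk₁ hk₂ (by
        rw [integral_sub (hw.continuous.integrable_of_hasCompactSupport hws)
          ((hw₀d.continuous.integrable_of_hasCompactSupport hw₀s).const_mul _),
          integral_const_mul, hw₀i]
        simp [ht])
    have h1 := h φ hφ hφs hφt
    rw [hφd] at h1
    have h2 : ∫ x, D x * (w x - t * w₀ x) = (∫ x, D x * w x) - t * m := by
      rw [hm, ← integral_const_mul, ← integral_sub (hint hw hws) ((hint hw₀d hw₀s).const_mul _)]
      congr 1
      ext x
      ring
    rw [h2] at h1
    have h3 : ∫ x, w x • (D x - m) = (∫ x, D x * w x) - m * t := by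
      rw [ht, ← integral_const_mul, ← integral_sub (hint hw hws)
        ((hw.continuous.integrable_of_hasCompactSupport hws).const_mul _)]
      congr 1
      ext x
      simp only [smul_eq_mul]
      ring
    rw [h3]
    linarith
  have hae := isOpen_Ioo.ae_eq_zero_of_integral_contDiff_smul_eq_zero (μ := volume)
    ((hD.sub continuous_const).locallyIntegrable.locallyIntegrableOn _) key
  have heq : EqOn (fun x => D x - m) (fun _ => 0) (Ioo c d) := by
    refine Measure.eqOn_open_of_ae_eq (μ := volume) ?_ isOpen_Ioo
      (hD.sub continuous_const).continuousOn continuousOn_const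
    exact (ae_restrict_iff' measurableSet_Ioo).mpr hae
  have h1 := heq hx₁
  have h2 := heq hx₂
  simp only at h1 h2
  linarith

/-- A continuous function whose weak derivative is a continuous function `B` is a primitive
of `B`. -/
lemma sub_eq_integral_of_weak_deriv {A B : ℝ → ℝ} {c d : ℝ} (hA : Continuous A)
    (hB : Continuous B)
    (h : ∀ φ : ℝ → ℝ, ContDiff ℝ ∞ φ → HasCompactSupport φ → tsupport φ ⊆ Ioo c d →
      ∫ x, (A x * deriv φ x + B x * φ x) = 0) :
    ∀ x₁ ∈ Ioo c d, ∀ x₂ ∈ Ioo c d, A x₂ - A x₁ = ∫ x in x₁..x₂, B x := by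
  intro x₁ hx₁ x₂ hx₂
  set G : ℝ → ℝ := fun x => ∫ ξ in x₁..x, B ξ with hG
  have hGd : ∀ x, HasDerivAt G (B x) x := fun x =>
    intervalIntegral.integral_hasDerivAt_right (hB.intervalIntegrable _ _)
      hB.aestronglyMeasurable.stronglyMeasurableAtFilter hB.continuousAt
  have hGc : Continuous G := continuous_iff_continuousAt.mpr fun x => (hGd x).continuousAt
  have := eq_of_weak_deriv_eq_zero (D := fun x => A x - G x) (hA.sub hGc) (by
    intro φ hφ hφs hφt
    have hφ' : Continuous (deriv φ) := hφ.continuous_deriv (by simp)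
    have h1 : ∫ x, (B x * φ x + G x * deriv φ x) = 0 := by
      refine integral_eq_zero_of_hasDerivAt_of_integrable (f := fun x => G x * φ x) (fun x => ?_)
        ?_ ((hGc.mul hφ.continuous).integrable_of_hasCompactSupport hφs.mul_left)
      · exact (hGd x).mul ((hφ.differentiable (by simp)) x).hasDerivAt
      · exact ((hB.mul hφ.continuous).integrable_of_hasCompactSupport hφs.mul_left).add
          ((hGc.mul hφ').integrable_of_hasCompactSupport hφs.deriv.mul_left)
    have h2 := h φ hφ hφs hφt
    have h3 : ∫ x, (A x - G x) * deriv φ x =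
        (∫ x, (A x * deriv φ x + B x * φ x)) - ∫ x, (B x * φ x + G x * deriv φ x) := by
      rw [← integral_sub]
      · congr 1
        ext x
        ring
      · exact ((hA.mul hφ').integrable_of_hasCompactSupport hφs.deriv.mul_left).add
          ((hB.mul hφ.continuous).integrable_of_hasCompactSupport hφs.mul_left)
      · exact ((hB.mul hφ.continuous).integrable_of_hasCompactSupport hφs.mul_left).add
          ((hGc.mul hφ').integrable_of_hasCompactSupport hφs.deriv.mul_left)
    rw [h3, h1, h2, sub_zero]) x₁ hx₁ x₂ hx₂
  simp only [hG, intervalIntegral.integral_same] at this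
  linarith

lemma integral_eq_intervalIntegral_of_tsupport {g χ : ℝ → ℝ} {c d : ℝ}
    (hχ : tsupport χ ⊆ Ioo c d) (hg : Function.support g ⊆ tsupport χ) :
    ∫ y, g y = ∫ y in c..d, g y :=
  (intervalIntegral.integral_eq_integral_of_support_subset
    (hg.trans (hχ.trans Ioo_subset_Ioc_self))).symm

/-- The weak form of `div (a, b) = K`, tested with products, gives the flux identity. -/
lemma rectFlux_of_weak {a b K : ℝ → ℝ → ℝ} {x₀ y₀ r : ℝ}
    (ha : Continuous (Function.uncurry a)) (hb : Continuous (Function.uncurry b))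
    (hK : Continuous (Function.uncurry K))
    (h : ∀ φ χ : ℝ → ℝ, ContDiff ℝ ∞ φ → HasCompactSupport φ →
      tsupport φ ⊆ Ioo (x₀ - r) (x₀ + r) → ContDiff ℝ ∞ χ → HasCompactSupport χ →
      tsupport χ ⊆ Ioo (y₀ - r) (y₀ + r) →
      ∫ x, ∫ y, (a x y * (deriv φ x * χ y) + b x y * (φ x * deriv χ y) +
        K x y * (φ x * χ y)) = 0) :
    RectFlux a b K x₀ y₀ r := by
  intro x₁ hx₁ x₂ hx₂ y₁ hy₁ y₂ hy₂
  have hax : ∀ x, Continuous (a x) := fun x =>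
    ha.comp (by fun_prop : Continuous fun y : ℝ => (x, y))
  have hbx : ∀ x, Continuous (b x) := fun x =>
    hb.comp (by fun_prop : Continuous fun y : ℝ => (x, y))
  have hKx : ∀ x, Continuous (K x) := fun x =>
    hK.comp (by fun_prop : Continuous fun y : ℝ => (x, y))
  have hby : ∀ y, Continuous fun x => b x y := fun y =>
    hb.comp (by fun_prop : Continuous fun x : ℝ => (x, y))
  have hKy : ∀ y, Continuous fun x => K x y := fun y =>
    hK.comp (by fun_prop : Continuous fun x : ℝ => (x, y))
  set β : ℝ → ℝ := fun y => ∫ x in x₁..x₂, b x y with hβ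
  set κ : ℝ → ℝ := fun y => ∫ x in x₁..x₂, K x y with hκ
  have hβc : Continuous β :=
    intervalIntegral.continuous_parametric_intervalIntegral_of_continuous'
      (f := fun y x => b x y) (hb.comp continuous_swap) _ _
  have hκc : Continuous κ :=
    intervalIntegral.continuous_parametric_intervalIntegral_of_continuous'
      (f := fun y x => K x y) (hK.comp continuous_swap) _ _
  have hac : Continuous fun y => a x₂ y - a x₁ y := (hax _).sub (hax _)
  -- The one-dimensional lemma is used twice. With `χ` fixed, `h1` applies it in `x` to `∫ a x y * χ
  -- y dy`; the result, for all `χ`, is the weak equation in `y` for `β`.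
  have key := sub_eq_integral_of_weak_deriv (A := β) (B := fun y => κ y - (a x₂ y - a x₁ y))
    (c := y₀ - r) (d := y₀ + r) hβc (hκc.sub hac) (by
    intro χ hχ hχs hχt
    have hχc := hχ.continuous
    have hχ'c : Continuous (deriv χ) := hχ.continuous_deriv (by simp)
    have hχz : ∀ y, y ∉ tsupport χ → χ y = 0 ∧ deriv χ y = 0 := fun y hy =>
      ⟨image_eq_zero_of_notMem_tsupport hy, by
        by_contra hne
        exact hy (support_deriv_subset hne)⟩
    set A : ℝ → ℝ := fun x => ∫ y in (y₀ - r)..(y₀ + r), a x y * χ y with hA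
    set B : ℝ → ℝ := fun x => ∫ y in (y₀ - r)..(y₀ + r), (b x y * deriv χ y + K x y * χ y) with hB
    have hAf : Continuous (Function.uncurry fun x y => a x y * χ y) :=
      ha.mul (hχc.comp continuous_snd)
    have hBf : Continuous (Function.uncurry fun x y => b x y * deriv χ y + K x y * χ y) :=
      (hb.mul (hχ'c.comp continuous_snd)).add (hK.mul (hχc.comp continuous_snd))
    have hAc : Continuous A :=
      intervalIntegral.continuous_parametric_intervalIntegral_of_continuous' hAf _ _
    have hBc : Continuous B :=
      intervalIntegral.continuous_parametric_intervalIntegral_of_continuous' hBf _ _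
    have h1 := sub_eq_integral_of_weak_deriv hAc hBc (c := x₀ - r) (d := x₀ + r) (by
      intro φ hφ hφs hφt
      rw [← h φ χ hφ hφs hφt hχ hχs hχt]
      congr 1
      ext x
      rw [integral_eq_intervalIntegral_of_tsupport hχt (by
        intro y hy
        by_contra hyn
        apply hy
        simp [hχz y hyn])]
      rw [hA, hB]
      simp only
      rw [mul_comm _ (deriv φ x), mul_comm _ (φ x), ← intervalIntegral.integral_const_mul,
        ← intervalIntegral.integral_const_mul, ← intervalIntegral.integral_add]
      · congr 1
        ext y
        ring
      · exact (continuous_const.mul ((hax x).mul hχc)).intervalIntegrable _ _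
      · exact (continuous_const.mul (((hbx x).mul hχ'c).add
          ((hKx x).mul hχc))).intervalIntegrable _ _) x₁ hx₁ x₂ hx₂
    have h2 : ∫ x in x₁..x₂, B x =
        ∫ y in (y₀ - r)..(y₀ + r), (β y * deriv χ y + κ y * χ y) := by
      rw [hB, intervalIntegral_intervalIntegral_swap ((hBf.continuousOn.integrableOn_compact
        (isCompact_uIcc.prod isCompact_uIcc)).mono_set
          (Set.prod_mono uIoc_subset_uIcc uIoc_subset_uIcc))]
      congr 1
      ext y
      rw [intervalIntegral.integral_add, intervalIntegral.integral_mul_const,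
        intervalIntegral.integral_mul_const]
      · exact ((hby y).mul continuous_const).intervalIntegrable _ _
      · exact ((hKy y).mul continuous_const).intervalIntegrable _ _
    have h3 : A x₂ - A x₁ = ∫ y in (y₀ - r)..(y₀ + r), (a x₂ y - a x₁ y) * χ y := by
      simp only [hA]
      rw [← intervalIntegral.integral_sub]
      · congr 1
        ext y
        ring
      · exact ((hax _).mul hχc).intervalIntegrable _ _
      · exact ((hax _).mul hχc).intervalIntegrable _ _
    rw [integral_eq_intervalIntegral_of_tsupport hχt (by
      intro y hy
      by_contra hyn
      apply hy
      simp [hχz y hyn])]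
    have h4 : ∫ y in (y₀ - r)..(y₀ + r), (β y * deriv χ y + (κ y - (a x₂ y - a x₁ y)) * χ y) =
        (∫ y in (y₀ - r)..(y₀ + r), (β y * deriv χ y + κ y * χ y)) -
          ∫ y in (y₀ - r)..(y₀ + r), (a x₂ y - a x₁ y) * χ y := by
      rw [← intervalIntegral.integral_sub]
      · congr 1
        ext y
        ring
      · exact ((hβc.mul hχ'c).add (hκc.mul hχc)).intervalIntegrable _ _
      · exact (hac.mul hχc).intervalIntegrable _ _
    rw [h4, ← h2, ← h3, h1, sub_self]) y₁ hy₁ y₂ hy₂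
  rw [intervalIntegral.integral_sub (hκc.intervalIntegrable _ _) (hac.intervalIntegrable _ _)]
    at key
  rw [intervalIntegral.integral_sub ((hby _).intervalIntegrable _ _)
    ((hby _).intervalIntegrable _ _), intervalIntegral_intervalIntegral_swap
      ((hK.continuousOn.integrableOn_compact (isCompact_uIcc.prod isCompact_uIcc)).mono_set
          (Set.prod_mono uIoc_subset_uIcc uIoc_subset_uIcc))]
  simp only [hβ, hκ] at key
  linarith

/-! ### Transfer to the Euclidean plane. -/

/-- The standard identification of `ℝ × ℝ` with the Euclidean plane. -/
def toPlane : ℝ × ℝ →L[ℝ] Plane :=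
  (ContinuousLinearMap.fst ℝ ℝ ℝ).smulRight (!₂[1, 0] : Plane) +
    (ContinuousLinearMap.snd ℝ ℝ ℝ).smulRight (!₂[0, 1] : Plane)

/-- The standard identification of the Euclidean plane with `ℝ × ℝ`. -/
def ofPlane : Plane →L[ℝ] ℝ × ℝ :=
  (EuclideanSpace.proj 0 : Plane →L[ℝ] ℝ).prod (EuclideanSpace.proj 1 : Plane →L[ℝ] ℝ)

lemma toPlane_apply (q : ℝ × ℝ) : toPlane q = !₂[q.1, q.2] := by
  ext i
  fin_cases i <;> simp [toPlane]

@[simp] lemma toPlane_zero (q : ℝ × ℝ) : toPlane q 0 = q.1 := by simp [toPlane]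

@[simp] lemma toPlane_one (q : ℝ × ℝ) : toPlane q 1 = q.2 := by simp [toPlane]

@[simp] lemma ofPlane_apply (p : Plane) : ofPlane p = (p 0, p 1) := rfl

lemma toPlane_ofPlane (p : Plane) : toPlane (p 0, p 1) = p := by
  ext i
  fin_cases i <;> simp

lemma inner_plane (v w : Plane) : inner ℝ v w = v 0 * w 0 + v 1 * w 1 := by
  simp [PiLp.inner_apply, Fin.sum_univ_two]
  ring

lemma HasDerivAt.plane_apply {γ : ℝ → Plane} {v : Plane} {σ : ℝ} (h : HasDerivAt γ v σ)
    (i : Fin 2) : HasDerivAt (fun σ => γ σ i) (v i) σ :=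
  (EuclideanSpace.proj i : Plane →L[ℝ] ℝ).hasFDerivAt.comp_hasDerivAt σ h

lemma hasDerivAt_toPlane_left (x y : ℝ) :
    HasDerivAt (fun x => toPlane (x, y)) !₂[1, 0] x :=
  (toPlane.hasFDerivAt.comp_hasDerivAt x ((hasDerivAt_id x).prodMk
    (hasDerivAt_const x y))).congr_deriv (toPlane_apply _)

lemma hasDerivAt_toPlane_right (x y : ℝ) :
    HasDerivAt (fun y => toPlane (x, y)) !₂[0, 1] y :=
  (toPlane.hasFDerivAt.comp_hasDerivAt y ((hasDerivAt_const y x).prodMk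
    (hasDerivAt_id y))).congr_deriv (toPlane_apply _)

/-- The retraction of the plane onto the closed square of radius `r` about `p₀`. -/
def clampPlane (p₀ : Plane) (r : ℝ) (q : ℝ × ℝ) : Plane :=
  toPlane (clamp (p₀ 0) r q.1, clamp (p₀ 1) r q.2)

/-- The closed square of radius `r` about `p₀`. -/
def square (p₀ : Plane) (r : ℝ) : Set Plane :=
  {p | p 0 ∈ Icc (p₀ 0 - r) (p₀ 0 + r) ∧ p 1 ∈ Icc (p₀ 1 - r) (p₀ 1 + r)}

lemma continuous_clampPlane (p₀ : Plane) (r : ℝ) : Continuous (clampPlane p₀ r) := by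
  unfold clampPlane; fun_prop

lemma clampPlane_mem (p₀ : Plane) {r : ℝ} (hr : 0 ≤ r) (q : ℝ × ℝ) :
    clampPlane p₀ r q ∈ square p₀ r := by
  constructor
  · simpa [clampPlane] using clamp_mem hr q.1
  · simpa [clampPlane] using clamp_mem hr q.2

lemma clampPlane_of_mem {p₀ p : Plane} {r : ℝ} (hp : p ∈ square p₀ r) :
    clampPlane p₀ r (p 0, p 1) = p := by
  rw [clampPlane]
  simp only [clamp_of_mem hp.1, clamp_of_mem hp.2]
  exact toPlane_ofPlane p

lemma exists_plane_square_subset {A : Set Plane} {p₀ : Plane} (hA : A ∈ 𝓝 p₀) :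
    ∃ r > 0, square p₀ r ⊆ A := by
  have h1 : toPlane ⁻¹' A ∈ 𝓝 (p₀ 0, p₀ 1) := by
    apply toPlane.continuous.continuousAt.preimage_mem_nhds
    rwa [toPlane_ofPlane]
  obtain ⟨r, hr, h⟩ := exists_square_subset h1
  refine ⟨r, hr, fun p hp => ?_⟩
  have := h (show (p 0, p 1) ∈ _ from ⟨hp.1, hp.2⟩)
  rwa [mem_preimage, toPlane_ofPlane] at this

/-- Near `p₀` there is a function `s` with `∇s = f V^⊥`, where `f > 0` has logarithmic
derivative `-K` along `V`. -/
def HasStraightening (V : Plane → Plane) (K : Plane → ℝ) (Ω : Set Plane) (p₀ : Plane) : Prop :=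
  ∃ (U : Set Plane) (s f : Plane → ℝ), IsOpen U ∧ p₀ ∈ U ∧ U ⊆ Ω ∧ ContinuousOn f U ∧
    (∀ p ∈ U, 0 < f p) ∧ (∀ p ∈ U, HasGradientAt s (f p • perp (V p)) p) ∧
    ∀ (I : Set ℝ) (γ : ℝ → Plane) (c : ℝ → ℝ), IsOpen I → I.OrdConnected →
      (∀ σ ∈ I, HasDerivAt γ (c σ • V (γ σ)) σ) → MapsTo γ I U →
      ∀ σ ∈ I, HasDerivAt (fun σ => f (γ σ)) (-(c σ * K (γ σ) * f (γ σ))) σ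

lemma hasStraightening_of_rectFlux {V : Plane → Plane} {K : Plane → ℝ} {Ω : Set Plane}
    {p₀ : Plane} {r : ℝ} (hr : 0 < r) (hsub : square p₀ r ⊆ Ω) (hV : ContinuousOn V Ω)
    (hK : ContinuousOn K Ω) (hne : V p₀ ≠ 0)
    (hflux : RectFlux (fun x y => V (clampPlane p₀ r (x, y)) 0)
      (fun x y => V (clampPlane p₀ r (x, y)) 1) (fun x y => K (clampPlane p₀ r (x, y)))
      (p₀ 0) (p₀ 1) r) :
    HasStraightening V K Ω p₀ := by
  have hVc : Continuous fun q => V (clampPlane p₀ r q) :=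
    hV.comp_continuous (continuous_clampPlane p₀ r) fun q => hsub (clampPlane_mem p₀ hr.le q)
  have hKc : Continuous fun q => K (clampPlane p₀ r q) :=
    hK.comp_continuous (continuous_clampPlane p₀ r) fun q => hsub (clampPlane_mem p₀ hr.le q)
  have hp₀ : p₀ ∈ square p₀ r := by
    constructor <;> constructor <;> linarith
  obtain ⟨U, s, f, hU, hpU, hf, hpos, hs, hc⟩ := hflux.straightensAt
    (by exact (EuclideanSpace.proj 0 : Plane →L[ℝ] ℝ).continuous.comp hVc)
    (by exact (EuclideanSpace.proj 1 : Plane →L[ℝ] ℝ).continuous.comp hVc) (by exact hKc) hr (by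
      rw [clampPlane_of_mem hp₀]
      by_contra! h
      apply hne
      ext i
      fin_cases i
      · exact h.1
      · exact h.2)
  set B : Set Plane := ofPlane ⁻¹' (Ioo (p₀ 0 - r) (p₀ 0 + r) ×ˢ Ioo (p₀ 1 - r) (p₀ 1 + r))
    with hB
  have hBo : IsOpen B := (isOpen_Ioo.prod isOpen_Ioo).preimage ofPlane.continuous
  have hBs : B ⊆ square p₀ r := fun p hp =>
    ⟨Ioo_subset_Icc_self hp.1, Ioo_subset_Icc_self hp.2⟩
  -- For `V = (a, b)`, `perp V` is dual to `b dx - a dy`, the negative of the form in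
  -- `StraightensAt`; hence `-s`.
  refine ⟨ofPlane ⁻¹' U ∩ B, fun p => -s (ofPlane p), fun p => f (ofPlane p),
    (hU.preimage ofPlane.continuous).inter hBo, ⟨hpU, ?_⟩,
    inter_subset_right.trans (hBs.trans hsub), ?_, fun p hp => hpos _ hp.1, ?_, ?_⟩
  · refine ⟨?_, ?_⟩ <;> constructor <;> simp only [ofPlane_apply] <;> linarith
  · exact hf.comp ofPlane.continuous.continuousOn fun p hp => hp.1
  · intro p hp
    rw [hasGradientAt_iff_hasFDerivAt]
    refine ((hs _ hp.1).comp p ofPlane.hasFDerivAt).neg.congr_fderiv ?_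
    ext v
    simp only [InnerProductSpace.toDual_apply_apply, inner_plane, ofPlane_apply,
      clampPlane_of_mem (hBs hp.2)]
    simp [perp]
    ring
  · intro I γ c hIo hIc hγ hmaps σ hσ
    have hcl : ∀ τ ∈ I, clampPlane p₀ r (γ τ 0, γ τ 1) = γ τ := fun τ hτ =>
      clampPlane_of_mem (hBs (hmaps hτ).2)
    have := hc I (fun σ => γ σ 0) (fun σ => γ σ 1) c hIo hIc
      (fun τ hτ => (HasDerivAt.plane_apply (hγ τ hτ) 0).congr_deriv (by
        simp only [hcl τ hτ]; rfl))
      (fun τ hτ => (HasDerivAt.plane_apply (hγ τ hτ) 1).congr_deriv (by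
        simp only [hcl τ hτ]; rfl))
      (fun τ hτ => (hmaps hτ).1) σ hσ
    simp only [hcl σ hσ] at this
    exact this

lemma integral_plane (G : Plane → ℝ) : ∫ p, G p = ∫ q : ℝ × ℝ, G (toPlane q) := by
  rw [← (PiLp.volume_preserving_toLp (Fin 2)).integral_comp
    (MeasurableEquiv.toLp 2 (Fin 2 → ℝ)).measurableEmbedding,
    ← (volume_preserving_finTwoArrow ℝ).symm.integral_comp
      (MeasurableEquiv.finTwoArrow (α := ℝ)).symm.measurableEmbedding]
  congr 1
  ext q
  congr 1
  rw [toPlane_apply]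
  rfl

/-- Test functions `φ(x) χ(y)` are enough. Their supports lie in the square, where clamping changes
nothing, and Fubini gives the iterated integral of `rectFlux_of_weak`. -/
lemma DivEqWeakly.rectFlux {N : Plane → Plane} {H : Plane → ℝ} {Ω : Set Plane} {p₀ : Plane}
    {r : ℝ} (hr : 0 < r) (hΩ : IsOpen Ω) (hsub : square p₀ r ⊆ Ω) (hN : ContinuousOn N Ω)
    (hH : ContinuousOn H Ω) (h : DivEqWeakly N H Ω) :
    RectFlux (fun x y => N (clampPlane p₀ r (x, y)) 0)
      (fun x y => N (clampPlane p₀ r (x, y)) 1) (fun x y => H (clampPlane p₀ r (x, y)))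
      (p₀ 0) (p₀ 1) r := by
  have hNc : Continuous fun q => N (clampPlane p₀ r q) :=
    hN.comp_continuous (continuous_clampPlane p₀ r) fun q => hsub (clampPlane_mem p₀ hr.le q)
  have hHc : Continuous fun q => H (clampPlane p₀ r q) :=
    hH.comp_continuous (continuous_clampPlane p₀ r) fun q => hsub (clampPlane_mem p₀ hr.le q)
  have hN0 : Continuous fun q => N (clampPlane p₀ r q) 0 :=
    (EuclideanSpace.proj 0 : Plane →L[ℝ] ℝ).continuous.comp hNc
  have hN1 : Continuous fun q => N (clampPlane p₀ r q) 1 :=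
    (EuclideanSpace.proj 1 : Plane →L[ℝ] ℝ).continuous.comp hNc
  refine rectFlux_of_weak hN0 hN1 hHc fun φ χ hφ hφs hφt hχ hχs hχt => ?_
  have hφc := hφ.continuous
  have hχc := hχ.continuous
  have hφ'c : Continuous (deriv φ) := hφ.continuous_deriv (by simp)
  have hχ'c : Continuous (deriv χ) := hχ.continuous_deriv (by simp)
  set Φ : Plane → ℝ := fun p => φ (p 0) * χ (p 1) with hΦ
  have hφ0 : ContDiff ℝ ∞ fun p : Plane => φ (p 0) :=
    hφ.comp (EuclideanSpace.proj 0 : Plane →L[ℝ] ℝ).contDiff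
  have hχ1 : ContDiff ℝ ∞ fun p : Plane => χ (p 1) :=
    hχ.comp (EuclideanSpace.proj 1 : Plane →L[ℝ] ℝ).contDiff
  set S : Set Plane := toPlane '' (tsupport φ ×ˢ tsupport χ) with hS
  have hScpt : IsCompact S := (hφs.isCompact.prod hχs.isCompact).image toPlane.continuous
  have hzero : ∀ p, p ∉ S → (φ (p 0) = 0 ∧ deriv φ (p 0) = 0) ∨
      (χ (p 1) = 0 ∧ deriv χ (p 1) = 0) := by
    intro p hp
    have aux : ∀ (ψ : ℝ → ℝ) (x : ℝ), x ∉ tsupport ψ → ψ x = 0 ∧ deriv ψ x = 0 := fun ψ x hx =>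
      ⟨image_eq_zero_of_notMem_tsupport hx, by
        by_contra hne
        exact hx (support_deriv_subset hne)⟩
    by_cases h0 : p 0 ∈ tsupport φ
    · refine Or.inr (aux χ _ fun h1 => hp ⟨(p 0, p 1), ⟨h0, h1⟩, toPlane_ofPlane p⟩)
    · exact Or.inl (aux φ _ h0)
  have hΦS : Function.support Φ ⊆ S := by
    intro p hp
    by_contra hpS
    apply hp
    rcases hzero p hpS with h0 | h0 <;> simp [hΦ, h0.1]
  have hSsq : S ⊆ square p₀ r := by
    rintro _ ⟨q, hq, rfl⟩
    refine ⟨?_, ?_⟩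
    · rw [toPlane_zero]
      exact Ioo_subset_Icc_self (hφt hq.1)
    · rw [toPlane_one]
      exact Ioo_subset_Icc_self (hχt hq.2)
  have hgrad : ∀ p, gradient Φ p = !₂[deriv φ (p 0) * χ (p 1), φ (p 0) * deriv χ (p 1)] := by
    intro p
    apply HasGradientAt.gradient
    rw [hasGradientAt_iff_hasFDerivAt]
    have h0 := ((hφ.differentiable (by simp)) (p 0)).hasDerivAt.comp_hasFDerivAt p
      (EuclideanSpace.proj 0 : Plane →L[ℝ] ℝ).hasFDerivAt
    have h1 := ((hχ.differentiable (by simp)) (p 1)).hasDerivAt.comp_hasFDerivAt p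
      (EuclideanSpace.proj 1 : Plane →L[ℝ] ℝ).hasFDerivAt
    refine (h0.mul h1).congr_fderiv ?_
    ext v
    simp only [InnerProductSpace.toDual_apply_apply, inner_plane]
    simp
    ring
  have hweak := h Φ (hφ0.mul hχ1) (HasCompactSupport.of_support_subset_isCompact hScpt hΦS)
    ((closure_minimal hΦS hScpt.isClosed).trans (hSsq.trans hsub))
  set G₁ : Plane → ℝ := fun p =>
    N (clampPlane p₀ r (p 0, p 1)) 0 * (deriv φ (p 0) * χ (p 1)) +
      N (clampPlane p₀ r (p 0, p 1)) 1 * (φ (p 0) * deriv χ (p 1)) with hG₁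
  set G₂ : Plane → ℝ := fun p => H (clampPlane p₀ r (p 0, p 1)) * (φ (p 0) * χ (p 1)) with hG₂
  have hp0 : Continuous fun p : Plane => p 0 := by fun_prop
  have hp1 : Continuous fun p : Plane => p 1 := by fun_prop
  have hG₁c : Continuous G₁ :=
    ((hN0.comp ofPlane.continuous).mul ((hφ'c.comp hp0).mul (hχc.comp hp1))).add
      ((hN1.comp ofPlane.continuous).mul ((hφc.comp hp0).mul (hχ'c.comp hp1)))
  have hG₂c : Continuous G₂ :=
    (hHc.comp ofPlane.continuous).mul ((hφc.comp hp0).mul (hχc.comp hp1))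
  have hG₁z : ∀ p, p ∉ S → G₁ p = 0 := by
    intro p hp
    rcases hzero p hp with h0 | h0 <;> simp [hG₁, h0.1, h0.2]
  have hG₂z : ∀ p, p ∉ S → G₂ p = 0 := by
    intro p hp
    rcases hzero p hp with h0 | h0 <;> simp [hG₂, h0.1]
  have hSΩ : S ⊆ Ω := hSsq.trans hsub
  have hI₁ : ∫ p in Ω, inner ℝ (N p) (gradient Φ p) = ∫ p, G₁ p := by
    rw [← setIntegral_eq_integral_of_forall_compl_eq_zero (s := Ω)
      fun p hp => hG₁z p fun hpS => hp (hSΩ hpS)]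
    refine setIntegral_congr_fun hΩ.measurableSet fun p _ => ?_
    simp only [inner_plane, hgrad]
    by_cases hpS : p ∈ S
    · simp [hG₁, clampPlane_of_mem (hSsq hpS)]
    · rw [hG₁z p hpS]
      rcases hzero p hpS with h0 | h0 <;> simp [h0.1, h0.2]
  have hI₂ : ∫ p in Ω, H p * Φ p = ∫ p, G₂ p := by
    rw [← setIntegral_eq_integral_of_forall_compl_eq_zero (s := Ω)
      fun p hp => hG₂z p fun hpS => hp (hSΩ hpS)]
    refine setIntegral_congr_fun hΩ.measurableSet fun p _ => ?_
    by_cases hpS : p ∈ S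
    · simp [hG₂, hΦ, clampPlane_of_mem (hSsq hpS)]
    · rw [hG₂z p hpS]
      rcases hzero p hpS with h0 | h0 <;> simp [hΦ, h0.1]
  have hsupp : ∀ G : Plane → ℝ, (∀ p, p ∉ S → G p = 0) → HasCompactSupport G := fun G hG =>
    HasCompactSupport.intro hScpt hG
  rw [hI₁, hI₂, ← integral_add (hG₁c.integrable_of_hasCompactSupport (hsupp _ hG₁z))
    (hG₂c.integrable_of_hasCompactSupport (hsupp _ hG₂z)), integral_plane,
    Measure.volume_eq_prod, integral_prod] at hweak
  · simpa [hG₁, hG₂] using hweak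
  · rw [← Measure.volume_eq_prod]
    refine Continuous.integrable_of_hasCompactSupport
      ((hG₁c.add hG₂c).comp toPlane.continuous)
      (HasCompactSupport.intro (hφs.isCompact.prod hχs.isCompact) fun q hq => ?_)
    have hqS : toPlane q ∉ S := by
      rintro ⟨q', hq', hqq⟩
      have h0 := congrArg (fun p : Plane => (p 0, p 1)) hqq
      simp only [toPlane_zero, toPlane_one] at h0
      exact hq ((show q' = q from h0) ▸ hq')
    simp only [hG₁z _ hqS, hG₂z _ hqS, add_zero]

/-! ### Flux and straightening of `(∇u + F)^⊥`. -/

lemma toPlane_mem_square {p₀ : Plane} {r x y : ℝ} (hx : x ∈ Ioo (p₀ 0 - r) (p₀ 0 + r))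
    (hy : y ∈ Ioo (p₀ 1 - r) (p₀ 1 + r)) : toPlane (x, y) ∈ square p₀ r :=
  ⟨by rw [toPlane_zero]; exact Ioo_subset_Icc_self hx,
    by rw [toPlane_one]; exact Ioo_subset_Icc_self hy⟩

lemma clampPlane_toPlane {p₀ : Plane} {r x y : ℝ} (hx : x ∈ Ioo (p₀ 0 - r) (p₀ 0 + r))
    (hy : y ∈ Ioo (p₀ 1 - r) (p₀ 1 + r)) : clampPlane p₀ r (x, y) = toPlane (x, y) := by
  have := clampPlane_of_mem (toPlane_mem_square hx hy)
  rwa [toPlane_zero, toPlane_one] at this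

lemma fderiv_apply_plane (u : Plane → ℝ) {p : Plane} (hu : DifferentiableAt ℝ u p) (v : Plane) :
    fderiv ℝ u p v = inner ℝ (gradient u p) v :=
  hu.hasGradientAt.fderiv_apply

lemma continuousOn_gradient {u : Plane → ℝ} {Ω : Set Plane} (hΩ : IsOpen Ω)
    (hu : ContDiffOn ℝ 1 u Ω) : ContinuousOn (gradient u) Ω :=
  (InnerProductSpace.toDual ℝ Plane).symm.continuous.comp_continuousOn
    (hu.continuousOn_fderiv_of_isOpen hΩ le_rfl)

lemma continuousOn_rot {F : Plane → Plane} {Ω : Set Plane} (hΩ : IsOpen Ω)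
    (hF : ContDiffOn ℝ 1 F Ω) : ContinuousOn (rot F) Ω := by
  have h := hF.continuousOn_fderiv_of_isOpen hΩ le_rfl
  have h1 : ∀ (v : Plane) (i : Fin 2), ContinuousOn (fun p => fderiv ℝ F p v i) Ω := fun v i =>
    (EuclideanSpace.proj i : Plane →L[ℝ] ℝ).continuous.comp_continuousOn
      (h.clm_apply continuousOn_const)
  exact (h1 _ 1).sub (h1 _ 0)

/-- The flux identity for `(∇u)^⊥`, whose divergence vanishes. -/
lemma rectFlux_perp_gradient {u : Plane → ℝ} {Ω : Set Plane} {p₀ : Plane} {r : ℝ} (hr : 0 < r)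
    (hΩ : IsOpen Ω) (hsub : square p₀ r ⊆ Ω) (hu : ContDiffOn ℝ 1 u Ω) :
    RectFlux (fun x y => gradient u (clampPlane p₀ r (x, y)) 1)
      (fun x y => -gradient u (clampPlane p₀ r (x, y)) 0) (fun _ _ => 0) (p₀ 0) (p₀ 1) r := by
  have hgc : ∀ i, Continuous fun q => gradient u (clampPlane p₀ r q) i := fun i =>
    (EuclideanSpace.proj i : Plane →L[ℝ] ℝ).continuous.comp
      ((continuousOn_gradient hΩ hu).comp_continuous (continuous_clampPlane p₀ r)
        fun q => hsub (clampPlane_mem p₀ hr.le q))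
  have hd : ∀ x ∈ Ioo (p₀ 0 - r) (p₀ 0 + r), ∀ y ∈ Ioo (p₀ 1 - r) (p₀ 1 + r),
      HasFDerivAt u (fderiv ℝ u (toPlane (x, y))) (toPlane (x, y)) := fun x hx y hy =>
    ((hu.differentiableOn one_ne_zero).differentiableAt
      (hΩ.mem_nhds (hsub (toPlane_mem_square hx hy)))).hasFDerivAt
  -- Since `u` is only `C¹`, mixed derivatives are avoided: the vertical and the horizontal sides
  -- telescope to opposite alternating sums of the corner values of `u`.
  have hv : ∀ x ∈ Ioo (p₀ 0 - r) (p₀ 0 + r), ∀ y₁ ∈ Ioo (p₀ 1 - r) (p₀ 1 + r),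
      ∀ y₂ ∈ Ioo (p₀ 1 - r) (p₀ 1 + r),
      ∫ y in y₁..y₂, gradient u (clampPlane p₀ r (x, y)) 1 =
        u (toPlane (x, y₂)) - u (toPlane (x, y₁)) := by
    intro x hx y₁ hy₁ y₂ hy₂
    refine intervalIntegral.integral_eq_sub_of_hasDerivAt (f := fun y => u (toPlane (x, y)))
      (fun y hy => ?_)
      ((hgc 1).comp (by fun_prop : Continuous fun y : ℝ => (x, y))).continuousOn.intervalIntegrable
    have hy' := ordConnected_Ioo.uIcc_subset hy₁ hy₂ hy
    refine ((hd x hx y hy').comp_hasDerivAt y (hasDerivAt_toPlane_right x y)).congr_deriv ?_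
    rw [fderiv_apply_plane u (hd x hx y hy').differentiableAt, clampPlane_toPlane hx hy',
      inner_plane]
    simp
  have hh : ∀ y ∈ Ioo (p₀ 1 - r) (p₀ 1 + r), ∀ x₁ ∈ Ioo (p₀ 0 - r) (p₀ 0 + r),
      ∀ x₂ ∈ Ioo (p₀ 0 - r) (p₀ 0 + r),
      ∫ x in x₁..x₂, gradient u (clampPlane p₀ r (x, y)) 0 =
        u (toPlane (x₂, y)) - u (toPlane (x₁, y)) := by
    intro y hy x₁ hx₁ x₂ hx₂
    refine intervalIntegral.integral_eq_sub_of_hasDerivAt (f := fun x => u (toPlane (x, y)))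
      (fun x hx => ?_)
      ((hgc 0).comp (by fun_prop : Continuous fun x : ℝ => (x, y))).continuousOn.intervalIntegrable
    have hx' := ordConnected_Ioo.uIcc_subset hx₁ hx₂ hx
    refine ((hd x hx' y hy).comp_hasDerivAt x (hasDerivAt_toPlane_left x y)).congr_deriv ?_
    rw [fderiv_apply_plane u (hd x hx' y hy).differentiableAt, clampPlane_toPlane hx' hy,
      inner_plane]
    simp
  intro x₁ hx₁ x₂ hx₂ y₁ hy₁ y₂ hy₂
  have hi : ∀ x i, Continuous fun y => gradient u (clampPlane p₀ r (x, y)) i := fun x i =>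
    (hgc i).comp (by fun_prop : Continuous fun y : ℝ => (x, y))
  have hj : ∀ y i, Continuous fun x => gradient u (clampPlane p₀ r (x, y)) i := fun y i =>
    (hgc i).comp (by fun_prop : Continuous fun x : ℝ => (x, y))
  rw [intervalIntegral.integral_sub ((hi _ _).intervalIntegrable _ _)
    ((hi _ _).intervalIntegrable _ _), hv x₁ hx₁ y₁ hy₁ y₂ hy₂, hv x₂ hx₂ y₁ hy₁ y₂ hy₂]
  simp only [neg_sub_neg]
  rw [intervalIntegral.integral_sub ((hj _ _).intervalIntegrable _ _)
    ((hj _ _).intervalIntegrable _ _), hh y₁ hy₁ x₁ hx₁ x₂ hx₂, hh y₂ hy₂ x₁ hx₁ x₂ hx₂]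
  simp only [intervalIntegral.integral_zero]
  ring

/-- The flux identity for `F^⊥`, whose divergence is `rot F`. -/
lemma rectFlux_perp {F : Plane → Plane} {Ω : Set Plane} {p₀ : Plane} {r : ℝ} (hr : 0 < r)
    (hΩ : IsOpen Ω) (hsub : square p₀ r ⊆ Ω) (hF : ContDiffOn ℝ 1 F Ω) :
    RectFlux (fun x y => F (clampPlane p₀ r (x, y)) 1)
      (fun x y => -F (clampPlane p₀ r (x, y)) 0) (fun x y => rot F (clampPlane p₀ r (x, y)))
      (p₀ 0) (p₀ 1) r := by
  have hgc : ∀ (v : Plane) i, Continuous fun q => fderiv ℝ F (clampPlane p₀ r q) v i := fun v i =>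
    (EuclideanSpace.proj i : Plane →L[ℝ] ℝ).continuous.comp
      (((hF.continuousOn_fderiv_of_isOpen hΩ le_rfl).clm_apply continuousOn_const).comp_continuous
        (continuous_clampPlane p₀ r) fun q => hsub (clampPlane_mem p₀ hr.le q))
  have hgx : ∀ (v : Plane) i y, Continuous fun x => fderiv ℝ F (clampPlane p₀ r (x, y)) v i :=
    fun v i y => (hgc v i).comp (by fun_prop : Continuous fun x : ℝ => (x, y))
  have hgy : ∀ (v : Plane) i x, Continuous fun y => fderiv ℝ F (clampPlane p₀ r (x, y)) v i :=
    fun v i x => (hgc v i).comp (by fun_prop : Continuous fun y : ℝ => (x, y))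
  have hd : ∀ x ∈ Ioo (p₀ 0 - r) (p₀ 0 + r), ∀ y ∈ Ioo (p₀ 1 - r) (p₀ 1 + r),
      HasFDerivAt F (fderiv ℝ F (toPlane (x, y))) (toPlane (x, y)) := fun x hx y hy =>
    ((hF.differentiableOn one_ne_zero).differentiableAt
      (hΩ.mem_nhds (hsub (toPlane_mem_square hx hy)))).hasFDerivAt
  intro x₁ hx₁ x₂ hx₂ y₁ hy₁ y₂ hy₂
  have h1 : ∀ y ∈ uIcc y₁ y₂, F (clampPlane p₀ r (x₂, y)) 1 - F (clampPlane p₀ r (x₁, y)) 1 =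
      ∫ x in x₁..x₂, fderiv ℝ F (clampPlane p₀ r (x, y)) !₂[1, 0] 1 := by
    intro y hy
    have hy' := ordConnected_Ioo.uIcc_subset hy₁ hy₂ hy
    rw [clampPlane_toPlane hx₁ hy', clampPlane_toPlane hx₂ hy']
    refine (intervalIntegral.integral_eq_sub_of_hasDerivAt (f := fun x => F (toPlane (x, y)) 1)
      (fun x hx => ?_) ((hgx _ _ _).intervalIntegrable _ _)).symm
    have hx' := ordConnected_Ioo.uIcc_subset hx₁ hx₂ hx
    rw [clampPlane_toPlane hx' hy']
    exact HasDerivAt.plane_apply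
      ((hd x hx' y hy').comp_hasDerivAt x (hasDerivAt_toPlane_left x y)) 1
  have h2 : ∀ x ∈ uIcc x₁ x₂, -F (clampPlane p₀ r (x, y₂)) 0 - -F (clampPlane p₀ r (x, y₁)) 0 =
      -∫ y in y₁..y₂, fderiv ℝ F (clampPlane p₀ r (x, y)) !₂[0, 1] 0 := by
    intro x hx
    have hx' := ordConnected_Ioo.uIcc_subset hx₁ hx₂ hx
    rw [clampPlane_toPlane hx' hy₁, clampPlane_toPlane hx' hy₂, neg_sub_neg, ← neg_sub]
    congr 1
    refine (intervalIntegral.integral_eq_sub_of_hasDerivAt (f := fun y => F (toPlane (x, y)) 0)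
      (fun y hy => ?_) ((hgy _ _ _).intervalIntegrable _ _)).symm
    have hy' := ordConnected_Ioo.uIcc_subset hy₁ hy₂ hy
    rw [clampPlane_toPlane hx' hy']
    exact HasDerivAt.plane_apply
      ((hd x hx' y hy').comp_hasDerivAt y (hasDerivAt_toPlane_right x y)) 0
  rw [intervalIntegral.integral_congr h1, intervalIntegral.integral_congr h2,
    intervalIntegral_intervalIntegral_swap, intervalIntegral.integral_neg, ← sub_eq_add_neg,
    ← intervalIntegral.integral_sub]
  · congr 1
    ext x
    rw [← intervalIntegral.integral_sub ((hgy _ _ _).intervalIntegrable _ _)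
      ((hgy _ _ _).intervalIntegrable _ _)]
    rfl
  · exact (intervalIntegral.continuous_parametric_intervalIntegral_of_continuous'
      (hgc !₂[1, 0] 1) _ _).intervalIntegrable _ _
  · exact (intervalIntegral.continuous_parametric_intervalIntegral_of_continuous'
      (hgc !₂[0, 1] 0) _ _).intervalIntegrable _ _
  · exact (((hgc !₂[1, 0] 1).comp continuous_swap).continuousOn.integrableOn_compact
      (isCompact_uIcc.prod isCompact_uIcc)).mono_set
        (Set.prod_mono uIoc_subset_uIcc uIoc_subset_uIcc)

lemma RectFlux.add {a b K a' b' K' : ℝ → ℝ → ℝ} {x₀ y₀ r : ℝ}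
    (ha : Continuous (Function.uncurry a)) (hb : Continuous (Function.uncurry b))
    (hK : Continuous (Function.uncurry K)) (ha' : Continuous (Function.uncurry a'))
    (hb' : Continuous (Function.uncurry b')) (hK' : Continuous (Function.uncurry K'))
    (h : RectFlux a b K x₀ y₀ r) (h' : RectFlux a' b' K' x₀ y₀ r) :
    RectFlux (fun x y => a x y + a' x y) (fun x y => b x y + b' x y)
      (fun x y => K x y + K' x y) x₀ y₀ r := by
  have hl : ∀ {g : ℝ → ℝ → ℝ}, Continuous (Function.uncurry g) → ∀ x, Continuous (g x) :=
    fun hg x => hg.comp (by fun_prop : Continuous fun y : ℝ => (x, y))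
  have hr : ∀ {g : ℝ → ℝ → ℝ}, Continuous (Function.uncurry g) → ∀ y, Continuous fun x => g x y :=
    fun hg y => hg.comp (by fun_prop : Continuous fun x : ℝ => (x, y))
  intro x₁ hx₁ x₂ hx₂ y₁ hy₁ y₂ hy₂
  have e := h x₁ hx₁ x₂ hx₂ y₁ hy₁ y₂ hy₂
  have e' := h' x₁ hx₁ x₂ hx₂ y₁ hy₁ y₂ hy₂
  have e1 : ∀ x, ∫ y in y₁..y₂, (K x y + K' x y) =
      (∫ y in y₁..y₂, K x y) + ∫ y in y₁..y₂, K' x y := fun x =>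
    intervalIntegral.integral_add ((hl hK x).intervalIntegrable _ _)
      ((hl hK' x).intervalIntegrable _ _)
  simp only [e1, add_sub_add_comm]
  rw [intervalIntegral.integral_add, intervalIntegral.integral_add, intervalIntegral.integral_add,
    ← e, ← e']
  · ring
  · exact (intervalIntegral.continuous_parametric_intervalIntegral_of_continuous'
      hK _ _).intervalIntegrable _ _
  · exact (intervalIntegral.continuous_parametric_intervalIntegral_of_continuous'
      hK' _ _).intervalIntegrable _ _
  · exact ((hr hb _).sub (hr hb _)).intervalIntegrable _ _
  · exact ((hr hb' _).sub (hr hb' _)).intervalIntegrable _ _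
  · exact ((hl ha _).sub (hl ha _)).intervalIntegrable _ _
  · exact ((hl ha' _).sub (hl ha' _)).intervalIntegrable _ _

lemma continuous_perp : Continuous perp := by
  unfold perp; fun_prop

/-- The unnormalized field `D N^⊥` is used because its divergence is `rot F`: the rotated gradient
contributes none. This is why `D` enters `∇t` and the equation for `g`. -/
lemma hasStraightening_perp {u : Plane → ℝ} {F : Plane → Plane} {Ω : Set Plane} {p₀ : Plane}
    (hΩ : IsOpen Ω) (hu : ContDiffOn ℝ 1 u Ω) (hF : ContDiffOn ℝ 1 F Ω) (hp₀ : p₀ ∈ Ω)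
    (hne : gradient u p₀ + F p₀ ≠ 0) :
    HasStraightening (fun p => perp (gradient u p + F p)) (rot F) Ω p₀ := by
  obtain ⟨r, hr, hsub⟩ := exists_plane_square_subset (hΩ.mem_nhds hp₀)
  have hcl : ∀ {X : Plane → Plane}, ContinuousOn X Ω →
      ∀ i, Continuous fun q => X (clampPlane p₀ r q) i := fun hX i =>
    (EuclideanSpace.proj i : Plane →L[ℝ] ℝ).continuous.comp (hX.comp_continuous
      (continuous_clampPlane p₀ r) fun q => hsub (clampPlane_mem p₀ hr.le q))
  have hgu := continuousOn_gradient hΩ hu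
  have hrot := continuousOn_rot hΩ hF
  refine hasStraightening_of_rectFlux hr hsub
    (continuous_perp.comp_continuousOn (hgu.add hF.continuousOn)) hrot ?_ ?_
  · intro h
    apply hne
    have h0 := congrFun (congrArg WithLp.ofLp h) 0
    have h1 := congrFun (congrArg WithLp.ofLp h) 1
    simp [perp] at h0 h1
    ext i
    fin_cases i
    · simp only [Fin.zero_eta, PiLp.add_apply, PiLp.zero_apply]
      linarith
    · simpa using h0
  · have h1 := rectFlux_perp_gradient hr hΩ hsub hu
    have h2 := rectFlux_perp hr hΩ hsub hF
    have hrc : Continuous fun q => rot F (clampPlane p₀ r q) :=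
      hrot.comp_continuous (continuous_clampPlane p₀ r) fun q => hsub (clampPlane_mem p₀ hr.le q)
    have h3 := RectFlux.add (by exact hcl hgu 1) (by exact (hcl hgu 0).neg)
      (by exact continuous_const) (by exact hcl hF.continuousOn 1)
      (by exact (hcl hF.continuousOn 0).neg) (by exact hrc) h1 h2
    simpa [perp, neg_add, add_comm] using h3

/-! ### The chart `(s, t)`: its coordinate lines and metric. -/

/-- A curve whose velocity is a positive multiple of `X` is, after reparametrization, an integral
curve of `X`. -/
lemma isIntegralCurveTrace_of_hasDerivAt {X : Plane → Plane} {c : ℝ → Plane} {ψ : ℝ → ℝ}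
    {x₀ r : ℝ} (hr : 0 < r) (hψ : ContinuousOn ψ (Icc (x₀ - r) (x₀ + r)))
    (hpos : ∀ x ∈ Icc (x₀ - r) (x₀ + r), 0 < ψ x)
    (hc : ∀ x ∈ Ioo (x₀ - r) (x₀ + r), HasDerivAt c (ψ x • X (c x)) x) :
    IsIntegralCurveTrace X (c '' Ioo (x₀ - r) (x₀ + r)) := by
  set χ : ℝ → ℝ := fun x => ψ (clamp x₀ r x) with hχ
  have hχc : Continuous χ := hψ.comp_continuous (continuous_clamp x₀ r) (clamp_mem hr.le)
  obtain ⟨x₁, hx₁, hmin⟩ := isCompact_Icc.exists_isMinOn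
    (nonempty_Icc.mpr (by linarith : x₀ - r ≤ x₀ + r)) hψ
  have hm : 0 < ψ x₁ := hpos x₁ hx₁
  have hχm : ∀ x, ψ x₁ ≤ χ x := fun x => hmin (clamp_mem hr.le x)
  -- The new parameter. The positive lower bound `ψ x₁` of `χ` makes `l` an increasing bijection of
  -- `ℝ`, so its inverse is defined globally.
  set l : ℝ → ℝ := fun x => ∫ ξ in x₀..x, χ ξ with hl
  have hld : ∀ x, HasDerivAt l (χ x) x := fun x =>
    intervalIntegral.integral_hasDerivAt_right (hχc.intervalIntegrable _ _)
      hχc.aestronglyMeasurable.stronglyMeasurableAtFilter hχc.continuousAt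
  have hlc : Continuous l := continuous_iff_continuousAt.mpr fun x => (hld x).continuousAt
  have hlmono : StrictMono l := strictMono_of_deriv_pos fun x => by
    rw [(hld x).deriv]
    exact hm.trans_le (hχm x)
  have hmono : Monotone fun x => l x - ψ x₁ * x := by
    have hd : ∀ x, HasDerivAt (fun x => l x - ψ x₁ * x) (χ x - ψ x₁ * 1) x := fun x =>
      (hld x).sub ((hasDerivAt_id x).const_mul _)
    refine monotone_of_deriv_nonneg (fun x => (hd x).differentiableAt) fun x => ?_
    rw [(hd x).deriv]
    linarith [hχm x]
  have htop : Tendsto l atTop atTop := by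
    refine tendsto_atTop_mono' atTop (f₁ := fun x => l 0 + ψ x₁ * x) ?_
      (tendsto_atTop_add_const_left _ _ (tendsto_id.const_mul_atTop hm))
    filter_upwards [eventually_ge_atTop 0] with x hx
    have := hmono hx
    simp only [mul_zero] at this
    linarith
  have hbot : Tendsto l atBot atBot := by
    refine tendsto_atBot_mono' atBot (f₁ := fun x => l 0 + ψ x₁ * x) ?_
      (tendsto_atBot_add_const_left _ _ (tendsto_id.const_mul_atBot hm))
    filter_upwards [eventually_le_atBot 0] with x hx
    have := hmono hx
    simp only [mul_zero] at this
    linarith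
  set e : ℝ ≃o ℝ := hlmono.orderIsoOfSurjective l (hlc.surjective htop hbot) with he
  have hecoe : ∀ x, e x = l x := fun x => rfl
  have hsymm : ∀ σ, HasDerivAt e.symm (χ (e.symm σ))⁻¹ σ := fun σ =>
    (hld (e.symm σ)).of_local_left_inverse e.symm.continuous.continuousAt
      (hm.trans_le (hχm _)).ne' (Eventually.of_forall fun y => e.apply_symm_apply y)
  have hmem : ∀ σ ∈ Ioo (e (x₀ - r)) (e (x₀ + r)), e.symm σ ∈ Ioo (x₀ - r) (x₀ + r) :=
    fun σ hσ => ⟨e.lt_symm_apply.mpr hσ.1, e.symm_apply_lt.mpr hσ.2⟩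
  refine ⟨Ioo (e (x₀ - r)) (e (x₀ + r)), fun σ => c (e.symm σ), isOpen_Ioo, ordConnected_Ioo,
    ⟨e x₀, e.strictMono (by linarith), e.strictMono (by linarith)⟩, ?_, ?_⟩
  · intro σ hσ
    have hx := hmem σ hσ
    refine HasDerivAt.hasDerivWithinAt ?_
    refine ((hc _ hx).scomp σ (hsymm σ)).congr_deriv ?_
    have h1 : χ (e.symm σ) = ψ (e.symm σ) := by
      simp only [hχ, clamp_of_mem (Ioo_subset_Icc_self hx)]
    rw [h1, smul_smul, inv_mul_cancel₀ (hpos _ (Ioo_subset_Icc_self hx)).ne', one_smul]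
  · ext p
    constructor
    · rintro ⟨σ, hσ, rfl⟩
      exact ⟨e.symm σ, hmem σ hσ, rfl⟩
    · rintro ⟨x, hx, rfl⟩
      exact ⟨e x, ⟨e.strictMono hx.1, e.strictMono hx.2⟩, by simp⟩

lemma perp_apply_zero (v : Plane) : perp v 0 = v 1 := rfl

lemma perp_apply_one (v : Plane) : perp v 1 = -v 0 := rfl

/-- The differential of `(s, t)` when `∇s = f n^⊥` and `∇t = k n` with `n` a unit vector. -/
def frameEquiv (n : Plane) (f k : ℝ) (hn : n 0 ^ 2 + n 1 ^ 2 = 1) (hf : f ≠ 0) (hk : k ≠ 0) :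
    Plane ≃L[ℝ] Plane :=
  ContinuousLinearEquiv.equivOfInverse
    (toPlane.comp ((InnerProductSpace.toDual ℝ Plane (f • perp n)).prod
      (InnerProductSpace.toDual ℝ Plane (k • n))))
    ((EuclideanSpace.proj 0 : Plane →L[ℝ] ℝ).smulRight (f⁻¹ • perp n) +
      (EuclideanSpace.proj 1 : Plane →L[ℝ] ℝ).smulRight (k⁻¹ • n))
    (fun p => by
      ext i
      fin_cases i
      · simp [toPlane, inner_plane, perp_apply_zero, perp_apply_one]
        field_simp
        linear_combination p 0 * hn
      · simp [toPlane, inner_plane, perp_apply_zero, perp_apply_one]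
        field_simp
        linear_combination p 1 * hn)
    (fun p => by
      ext i
      fin_cases i
      · simp [toPlane, inner_plane, perp_apply_zero, perp_apply_one]
        field_simp
        linear_combination k * p 0 * hn
      · simp [toPlane, inner_plane, perp_apply_zero, perp_apply_one]
        field_simp
        linear_combination f * p 1 * hn)

lemma contDiffOn_of_hasGradientAt {s : Plane → ℝ} {G : Plane → Plane} {U : Set Plane}
    (hU : IsOpen U) (hG : ContinuousOn G U) (hs : ∀ p ∈ U, HasGradientAt s (G p) p) :
    ContDiffOn ℝ 1 s U := by
  rw [show (1 : WithTop ℕ∞) = 0 + 1 from rfl, contDiffOn_succ_iff_fderiv_of_isOpen hU]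
  refine ⟨fun p hp => (hs p hp).differentiableAt.differentiableWithinAt, by simp, ?_⟩
  rw [contDiffOn_zero]
  refine ((InnerProductSpace.toDual ℝ Plane).continuous.comp_continuousOn hG).congr ?_
  exact fun p hp => (hs p hp).hasFDerivAt.fderiv

lemma frameEquiv_symm_apply (n : Plane) (f k : ℝ) (hn : n 0 ^ 2 + n 1 ^ 2 = 1) (hf : f ≠ 0)
    (hk : k ≠ 0) (w : Plane) :
    (frameEquiv n f k hn hf hk).symm w = w 0 • f⁻¹ • perp n + w 1 • k⁻¹ • n := rfl

lemma frameEquiv_apply_zero (n : Plane) (f k : ℝ) (hn : n 0 ^ 2 + n 1 ^ 2 = 1) (hf : f ≠ 0)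
    (hk : k ≠ 0) (v : Plane) : frameEquiv n f k hn hf hk v 0 = f * (n 1 * v 0 - n 0 * v 1) := by
  change toPlane (inner ℝ (f • perp n) v, inner ℝ (k • n) v) 0 = _
  rw [toPlane_zero]
  simp only [inner_plane, PiLp.smul_apply, perp_apply_zero,
    perp_apply_one, smul_eq_mul]
  ring

lemma frameEquiv_apply_one (n : Plane) (f k : ℝ) (hn : n 0 ^ 2 + n 1 ^ 2 = 1) (hf : f ≠ 0)
    (hk : k ≠ 0) (v : Plane) : frameEquiv n f k hn hf hk v 1 = k * (n 0 * v 0 + n 1 * v 1) := by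
  change toPlane (inner ℝ (f • perp n) v, inner ℝ (k • n) v) 1 = _
  rw [toPlane_one]
  simp only [inner_plane, PiLp.smul_apply, smul_eq_mul]
  ring

lemma hasFDerivAt_chart {s t : Plane → ℝ} {n p : Plane} {f k : ℝ} (hn : n 0 ^ 2 + n 1 ^ 2 = 1)
    (hf : f ≠ 0) (hk : k ≠ 0) (hs : HasGradientAt s (f • perp n) p)
    (ht : HasGradientAt t (k • n) p) :
    HasFDerivAt (fun p => (!₂[s p, t p] : Plane)) (frameEquiv n f k hn hf hk : Plane →L[ℝ] Plane)
      p := by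
  have h := toPlane.hasFDerivAt.comp p (hs.hasFDerivAt.prodMk ht.hasFDerivAt)
  refine (h.congr_of_eventuallyEq (Eventually.of_forall fun q => ?_)).congr_fderiv rfl
  exact (toPlane_apply (s q, t q)).symm

/-- Two functions with positively oriented orthogonal gradients are the coordinates of a chart
onto a square, whose coordinate lines are integral curves of `N^⊥` and `N`. -/
lemma exists_chart {N : Plane → Plane} {U : Set Plane} {s t f k : Plane → ℝ} {p₀ : Plane}
    (hU : IsOpen U) (hp₀ : p₀ ∈ U) (hN : ContinuousOn N U)
    (hN1 : ∀ p ∈ U, N p 0 ^ 2 + N p 1 ^ 2 = 1)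
    (hf : ContinuousOn f U) (hk : ContinuousOn k U) (hfpos : ∀ p ∈ U, 0 < f p)
    (hkpos : ∀ p ∈ U, 0 < k p) (hs : ∀ p ∈ U, HasGradientAt s (f p • perp (N p)) p)
    (ht : ∀ p ∈ U, HasGradientAt t (k p • N p) p) :
    ∃ (Ω' : Set Plane) (Φ : Plane → Plane), p₀ ∈ Ω' ∧ Ω' ⊆ U ∧
      IsC1DiffeoOn (fun p => !₂[s p, t p]) Φ Ω' ∧
      (∀ p ∈ Ω', IsIntegralCurveTrace (fun p => perp (N p)) {q ∈ Ω' | t q = t p}) ∧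
      ∀ p ∈ Ω', IsIntegralCurveTrace N {q ∈ Ω' | s q = s p} := by
  set Ψ : Plane → Plane := fun p => !₂[s p, t p] with hΨ
  have hsC := contDiffOn_of_hasGradientAt hU (hf.smul (continuous_perp.comp_continuousOn hN)) hs
  have htC := contDiffOn_of_hasGradientAt hU (hk.smul hN) ht
  have hΨC : ContDiffOn ℝ 1 Ψ U := by
    refine (toPlane.contDiff.comp_contDiffOn (hsC.prodMk htC)).congr fun p _ => ?_
    exact (toPlane_apply (s p, t p)).symm
  have hΨd : ∀ p (hp : p ∈ U), HasFDerivAt Ψ (frameEquiv (N p) (f p) (k p) (hN1 p hp)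
      (hfpos p hp).ne' (hkpos p hp).ne' : Plane →L[ℝ] Plane) p := fun p hp =>
    hasFDerivAt_chart _ _ _ (hs p hp) (ht p hp)
  have hΨat : ∀ p ∈ U, ContDiffAt ℝ 1 Ψ p := fun p hp => hΨC.contDiffAt (hU.mem_nhds hp)
  set e := (hΨat p₀ hp₀).toOpenPartialHomeomorph Ψ (hΨd p₀ hp₀) one_ne_zero with he
  have hsrc : p₀ ∈ e.source :=
    (hΨat p₀ hp₀).mem_toOpenPartialHomeomorph_source (hΨd p₀ hp₀) one_ne_zero
  have heΨ : ∀ p, e p = Ψ p := fun p => rfl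
  set T : Set Plane := e.target ∩ e.symm ⁻¹' U with hT
  have hTo : IsOpen T := e.isOpen_inter_preimage_symm hU
  have hT₀ : Ψ p₀ ∈ T :=
    ⟨e.map_source hsrc, by rw [mem_preimage, ← heΨ, e.left_inv hsrc]; exact hp₀⟩
  obtain ⟨δ, hδ, hδT⟩ := exists_plane_square_subset (hTo.mem_nhds hT₀)
  -- `Ω'` is the preimage of a square in the `(s, t)` plane, so each nonempty level set is the image
  -- of one whole segment, hence a single curve. The closed square still lies in `T`, which bounds
  -- the speeds on closed segments.
  set R : Set Plane := ofPlane ⁻¹' (Ioo (s p₀ - δ) (s p₀ + δ) ×ˢ Ioo (t p₀ - δ) (t p₀ + δ)) with hR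
  have hRo : IsOpen R := (isOpen_Ioo.prod isOpen_Ioo).preimage ofPlane.continuous
  have hRT : R ⊆ T := fun q hq =>
    hδT ⟨Ioo_subset_Icc_self hq.1, Ioo_subset_Icc_self hq.2⟩
  set Ω' : Set Plane := e.source ∩ Ψ ⁻¹' R with hΩ'
  have hΩ'o : IsOpen Ω' := e.isOpen_inter_preimage hRo
  have hmaps : ∀ q ∈ R, e.symm q ∈ Ω' ∧ Ψ (e.symm q) = q := by
    intro q hq
    have h1 : Ψ (e.symm q) = q := e.right_inv (hRT hq).1
    exact ⟨⟨e.map_target (hRT hq).1, by rw [mem_preimage, h1]; exact hq⟩, h1⟩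
  have hinv : ∀ p ∈ Ω', e.symm (Ψ p) = p := fun p hp => e.left_inv hp.1
  have hΩ'U : Ω' ⊆ U := by
    intro p hp
    have := (hRT hp.2).2
    rwa [mem_preimage, hinv p hp] at this
  have himage : Ψ '' Ω' = R := by
    ext q
    constructor
    · rintro ⟨p, hp, rfl⟩
      exact hp.2
    · exact fun hq => ⟨e.symm q, (hmaps q hq).1, (hmaps q hq).2⟩
  have hsymm : ∀ q (hq : q ∈ T), HasFDerivAt e.symm ((frameEquiv (N (e.symm q)) (f (e.symm q))
      (k (e.symm q)) (hN1 _ hq.2) (hfpos _ hq.2).ne' (hkpos _ hq.2).ne').symm :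
        Plane →L[ℝ] Plane) q := fun q hq =>
    e.hasFDerivAt_symm hq.1 (hΨd _ hq.2)
  have hsymmc : ContinuousOn e.symm T := e.symm.continuousOn.mono inter_subset_left
  have hfT : ContinuousOn (fun q => (f (e.symm q))⁻¹) T :=
    (hf.comp hsymmc fun q hq => hq.2).inv₀ fun q hq => (hfpos _ hq.2).ne'
  have hkT : ContinuousOn (fun q => (k (e.symm q))⁻¹) T :=
    (hk.comp hsymmc fun q hq => hq.2).inv₀ fun q hq => (hkpos _ hq.2).ne'
  refine ⟨Ω', e.symm, ⟨hsrc, ?_⟩, hΩ'U, ⟨hΩ'o, himage ▸ hRo, hΨC.mono hΩ'U, ?_, hinv⟩, ?_, ?_⟩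
  · refine ⟨?_, ?_⟩ <;> constructor <;> simp [hΨ] <;> linarith
  · rw [himage]
    intro q hq
    exact (e.contDiffAt_symm (hRT hq).1 (hΨd _ (hRT hq).2)
      (hΨat _ (hRT hq).2)).contDiffWithinAt
  · intro p hp
    have hmem : ∀ x ∈ Icc (s p₀ - δ) (s p₀ + δ), toPlane (x, t p) ∈ T := fun x hx =>
      hδT ⟨by simpa [hΨ] using hx, by
        rw [toPlane_one]; exact Ioo_subset_Icc_self hp.2.2⟩
    have htrace : {q ∈ Ω' | t q = t p} =
        (fun x => e.symm (toPlane (x, t p))) '' Ioo (s p₀ - δ) (s p₀ + δ) := by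
      ext q
      constructor
      · rintro ⟨hq, hqp⟩
        refine ⟨s q, hq.2.1, ?_⟩
        simp only [← hqp]
        rw [toPlane_apply]
        exact hinv q hq
      · rintro ⟨x, hx, rfl⟩
        have hq : toPlane (x, t p) ∈ R := by
          refine ⟨by simpa using hx, ?_⟩
          rw [ofPlane_apply, toPlane_one]
          exact hp.2.2
        refine ⟨(hmaps _ hq).1, ?_⟩
        have := congrArg (fun q : Plane => q 1) (hmaps _ hq).2
        simpa [hΨ] using this
    rw [htrace]
    refine isIntegralCurveTrace_of_hasDerivAt (ψ := fun x => (f (e.symm (toPlane (x, t p))))⁻¹) hδ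
      (hfT.comp (by fun_prop : Continuous fun x : ℝ => toPlane (x, t p)).continuousOn hmem)
      (fun x hx => inv_pos.mpr (hfpos _ (hmem x hx).2)) fun x hx => ?_
    refine ((hsymm _ (hmem x (Ioo_subset_Icc_self hx))).comp_hasDerivAt x
      (hasDerivAt_toPlane_left x (t p))).congr_deriv ?_
    rw [ContinuousLinearEquiv.coe_coe, frameEquiv_symm_apply]
    simp
  · intro p hp
    have hmem : ∀ y ∈ Icc (t p₀ - δ) (t p₀ + δ), toPlane (s p, y) ∈ T := fun y hy =>
      hδT ⟨by rw [toPlane_zero]; exact Ioo_subset_Icc_self hp.2.1, by simpa [hΨ] using hy⟩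
    have htrace : {q ∈ Ω' | s q = s p} =
        (fun y => e.symm (toPlane (s p, y))) '' Ioo (t p₀ - δ) (t p₀ + δ) := by
      ext q
      constructor
      · rintro ⟨hq, hqp⟩
        refine ⟨t q, hq.2.2, ?_⟩
        simp only [← hqp]
        rw [toPlane_apply]
        exact hinv q hq
      · rintro ⟨y, hy, rfl⟩
        have hq : toPlane (s p, y) ∈ R := by
          refine ⟨by rw [ofPlane_apply, toPlane_zero]; exact hp.2.1, ?_⟩
          simpa using hy
        refine ⟨(hmaps _ hq).1, ?_⟩
        have := congrArg (fun q : Plane => q 0) (hmaps _ hq).2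
        simpa [hΨ] using this
    rw [htrace]
    refine isIntegralCurveTrace_of_hasDerivAt (ψ := fun y => (k (e.symm (toPlane (s p, y))))⁻¹) hδ
      (hkT.comp (by fun_prop : Continuous fun y : ℝ => toPlane (s p, y)).continuousOn hmem)
      (fun y hy => inv_pos.mpr (hkpos _ (hmem y hy).2)) fun y hy => ?_
    refine ((hsymm _ (hmem y (Ioo_subset_Icc_self hy))).comp_hasDerivAt y
      (hasDerivAt_toPlane_right (s p) y)).congr_deriv ?_
    rw [ContinuousLinearEquiv.coe_coe, frameEquiv_symm_apply]
    simp

/-- As `perp n` and `n` are orthonormal, `ds / f` and `dt / k` form an orthonormal coframe, whose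
squares add up to the Euclidean metric. -/
lemma pullbackMetric_chart {s t : Plane → ℝ} {n p : Plane} {f k : ℝ}
    {a b : Plane → ℝ} (hn : n 0 ^ 2 + n 1 ^ 2 = 1) (hf : f ≠ 0) (hk : k ≠ 0)
    (hs : HasGradientAt s (f • perp n) p) (ht : HasGradientAt t (k • n) p)
    (ha : a !₂[s p, t p] = 1 / f ^ 2) (hb : b !₂[s p, t p] = 1 / k ^ 2) :
    pullbackMetric (fun p => !₂[s p, t p]) (diagMetric a b) p = euclMetric p := by
  have hd := (hasFDerivAt_chart hn hf hk hs ht).fderiv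
  refine LinearMap.ext fun v => LinearMap.ext fun w => ?_
  unfold pullbackMetric euclMetric diagMetric
  rw [hd]
  simp only [LinearMap.BilinForm.comp_apply, LinearMap.add_apply, LinearMap.smul_apply,
    LinearMap.BilinForm.linMulLin_apply, coordDiff, ha, hb]
  change 1 / f ^ 2 * ((frameEquiv n f k hn hf hk v) 0 * (frameEquiv n f k hn hf hk w) 0) +
    1 / k ^ 2 * ((frameEquiv n f k hn hf hk v) 1 * (frameEquiv n f k hn hf hk w) 1) =
    1 * (v 0 * w 0) + 1 * (v 1 * w 1)
  simp only [frameEquiv_apply_zero, frameEquiv_apply_one]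
  field_simp
  linear_combination (v 0 * w 0 + v 1 * w 1) * hn

lemma perp_smul (c : ℝ) (v : Plane) : perp (c • v) = c • perp v := by
  ext i
  fin_cases i <;> simp [perp]

lemma perp_perp (v : Plane) : perp (perp v) = -v := by
  ext i
  fin_cases i <;> simp [perp]

lemma normal_sq_add_sq {u : Plane → ℝ} {F : Plane → Plane} {p : Plane}
    (h : gradient u p + F p ≠ 0) : normal u F p 0 ^ 2 + normal u F p 1 ^ 2 = 1 := by
  have h1 : ‖normal u F p‖ = 1 := by
    rw [normal, norm_smul, norm_inv, density, norm_norm]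
    exact inv_mul_cancel₀ (norm_pos_iff.mpr h).ne'
  have h2 := real_inner_self_eq_norm_sq (normal u F p)
  rw [inner_plane, h1] at h2
  linarith

end PMean

end

/-! ### Combining the two straightenings. -/

open PMean in
theorem theoremC (Ω : Set PMean.Plane) (hΩo : IsOpen Ω) (hΩc : IsConnected Ω)
    (u : PMean.Plane → ℝ) (F : PMean.Plane → PMean.Plane) (H : PMean.Plane → ℝ)
    (hu : ContDiffOn ℝ 1 u Ω) (hF : ContDiffOn ℝ 1 F Ω) (hH : ContinuousOn H Ω)
    (hns : PMean.singularSet u F Ω = ∅)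
    (hsol : PMean.DivEqWeakly (PMean.normal u F) H Ω)
    (p₀ : PMean.Plane) (hp₀ : p₀ ∈ Ω) :
    ∃ (Ω' : Set PMean.Plane) (s t f g : PMean.Plane → ℝ),
      IsOpen Ω' ∧ p₀ ∈ Ω' ∧ Ω' ⊆ Ω ∧
      ContDiffOn ℝ 1 s Ω' ∧ ContDiffOn ℝ 1 t Ω' ∧
      -- level sets of `t` are characteristic curves, level sets of `s` are seed curves
      (∀ p ∈ Ω', PMean.IsIntegralCurveTrace (PMean.normalPerp u F) {q ∈ Ω' | t q = t p}) ∧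
      (∀ p ∈ Ω', PMean.IsIntegralCurveTrace (PMean.normal u F) {q ∈ Ω' | s q = s p}) ∧
      ContinuousOn f Ω' ∧ ContinuousOn g Ω' ∧
      (∀ p ∈ Ω', 0 < f p) ∧ (∀ p ∈ Ω', 0 < g p) ∧
      -- `∇s = f N^⊥` and `∇t = g D N`
      (∀ p ∈ Ω', HasGradientAt s (f p • PMean.normalPerp u F p) p) ∧
      (∀ p ∈ Ω', HasGradientAt t ((g p * PMean.density u F p) • PMean.normal u F p) p) ∧
      -- `N f` and `N^⊥ g` exist, are continuous and satisfy the two equations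
      (∃ Nf Ng : PMean.Plane → ℝ,
        ContinuousOn Nf Ω' ∧ ContinuousOn Ng Ω' ∧
        (∀ p ∈ Ω', PMean.HasDerivAlong (PMean.normal u F) Ω' f (Nf p) p) ∧
        (∀ p ∈ Ω', PMean.HasDerivAlong (PMean.normalPerp u F) Ω' g (Ng p) p) ∧
        (∀ p ∈ Ω', Nf p + f p * H p = 0) ∧
        (∀ p ∈ Ω', Ng p + PMean.rot F p * g p / PMean.density u F p = 0)) ∧
      -- `(s, t)` is a `C¹` diffeomorphism near `p₀`, with the stated pullback metric
      (∃ (Ω'' : Set PMean.Plane) (Φ : PMean.Plane → PMean.Plane),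
        p₀ ∈ Ω'' ∧ Ω'' ⊆ Ω' ∧
        PMean.IsC1DiffeoOn (fun p => !₂[s p, t p]) Φ Ω'' ∧
        ∀ p ∈ Ω'',
          PMean.pullbackMetric (fun p => !₂[s p, t p])
            (PMean.diagMetric (fun q => 1 / f (Φ q) ^ 2)
              (fun q => 1 / (g (Φ q) ^ 2 * PMean.density u F (Φ q) ^ 2))) p
            = PMean.euclMetric p) := by
  have hgu := continuousOn_gradient hΩo hu
  have hW : ContinuousOn (fun p => gradient u p + F p) Ω := hgu.add hF.continuousOn
  have hne : ∀ p ∈ Ω, gradient u p + F p ≠ 0 := fun p hp h => by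
    have : p ∈ singularSet u F Ω := ⟨hp, h⟩
    rw [hns] at this
    exact this
  have hDpos : ∀ p ∈ Ω, 0 < density u F p := fun p hp => norm_pos_iff.mpr (hne p hp)
  have hDc : ContinuousOn (density u F) Ω := hW.norm
  have hNc : ContinuousOn (normal u F) Ω := (hDc.inv₀ fun p hp => (hDpos p hp).ne').smul hW
  have hDN : ∀ p ∈ Ω, gradient u p + F p = density u F p • normal u F p := fun p hp => by
    rw [normal, smul_smul, mul_inv_cancel₀ (hDpos p hp).ne', one_smul]
  have hN1 : ∀ p ∈ Ω, normal u F p 0 ^ 2 + normal u F p 1 ^ 2 = 1 := fun p hp =>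
    normal_sq_add_sq (hne p hp)
  obtain ⟨r, hr, hsub⟩ := exists_plane_square_subset (hΩo.mem_nhds hp₀)
  have hN0 : normal u F p₀ ≠ 0 := fun h => by
    have := hN1 p₀ hp₀
    simp [h] at this
  obtain ⟨U₁, s, f, hU₁, hp₁, hU₁Ω, hf, hfpos, hs, hfc⟩ := hasStraightening_of_rectFlux hr hsub
    hNc hH hN0 (hsol.rectFlux hr hΩo hsub hNc hH)
  obtain ⟨U₂, t, g, hU₂, hp₂, hU₂Ω, hg, hgpos, ht, hgc⟩ :=
    hasStraightening_perp hΩo hu hF hp₀ (hne p₀ hp₀)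
  -- Rotating twice by `-π/2` gives `-1`, so the second straightening yields `∇t = -g D N`; `-t` is
  -- the required function.
  have htN : ∀ p ∈ U₂, HasGradientAt (fun p => -t p) ((g p * density u F p) • normal u F p) p := by
    intro p hp
    rw [hasGradientAt_iff_hasFDerivAt]
    refine (ht p hp).hasFDerivAt.neg.congr_fderiv ?_
    rw [mul_smul, ← hDN p (hU₂Ω hp), perp_perp, smul_neg, map_neg, neg_neg]
  have hi₁ : U₁ ∩ U₂ ⊆ U₁ := inter_subset_left
  have hi₂ : U₁ ∩ U₂ ⊆ U₂ := inter_subset_right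
  have hiΩ : U₁ ∩ U₂ ⊆ Ω := hi₁.trans hU₁Ω
  obtain ⟨Ω', Φ, hpΩ', hΩ'U, hdiff, htr₁, htr₂⟩ := exists_chart (N := normal u F)
    (U := U₁ ∩ U₂) (s := s) (t := fun p => -t p) (f := f) (k := fun p => g p * density u F p)
    (p₀ := p₀) (hU₁.inter hU₂) ⟨hp₁, hp₂⟩ (hNc.mono hiΩ) (fun p hp => hN1 p (hiΩ hp))
    (hf.mono hi₁) ((hg.mono hi₂).mul (hDc.mono hiΩ)) (fun p hp => hfpos p hp.1)
    (fun p hp => mul_pos (hgpos p hp.2) (hDpos p (hiΩ hp))) (fun p hp => hs p hp.1)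
    (fun p hp => htN p hp.2)
  have hΩ'₁ : Ω' ⊆ U₁ := hΩ'U.trans hi₁
  have hΩ'₂ : Ω' ⊆ U₂ := hΩ'U.trans hi₂
  have hΩ'Ω : Ω' ⊆ Ω := hΩ'U.trans hiΩ
  have hΩ'o : IsOpen Ω' := hdiff.1
  have hYc : ContinuousOn (normalPerp u F) Ω := continuous_perp.comp_continuousOn hNc
  have hrot := continuousOn_rot hΩo hF
  refine ⟨Ω', s, fun p => -t p, f, g, hΩ'o, hpΩ', hΩ'Ω,
    contDiffOn_of_hasGradientAt hΩ'o ((hf.mono hΩ'₁).smul (hYc.mono hΩ'Ω))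
      fun p hp => hs p (hΩ'₁ hp),
    contDiffOn_of_hasGradientAt hΩ'o (((hg.mono hΩ'₂).mul (hDc.mono hΩ'Ω)).smul (hNc.mono hΩ'Ω))
      fun p hp => htN p (hΩ'₂ hp),
    htr₁, htr₂, hf.mono hΩ'₁, hg.mono hΩ'₂, fun p hp => hfpos p (hΩ'₁ hp),
    fun p hp => hgpos p (hΩ'₂ hp), fun p hp => hs p (hΩ'₁ hp), fun p hp => htN p (hΩ'₂ hp),
    ⟨fun p => -(f p * H p), fun p => -(rot F p * g p / density u F p),
      ((hf.mono hΩ'₁).mul (hH.mono hΩ'Ω)).neg,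
      (((hrot.mono hΩ'Ω).mul (hg.mono hΩ'₂)).div (hDc.mono hΩ'Ω)
        fun p hp => (hDpos p (hΩ'Ω hp)).ne').neg, ?_, ?_, fun p _ => by ring, fun p _ => by ring⟩,
    Ω', Φ, hpΩ', subset_rfl, hdiff, ?_⟩
  -- The level set of `s` through `p` is the seed curve whose existence `HasDerivAlong` demands.
  · refine fun p hp => ⟨⟨_, htr₂ p hp, sep_subset _ _, hp, rfl⟩, ?_⟩
    rintro I γ hIo hIc hγ hmaps σ hσ rfl
    refine (hfc I γ (fun _ => 1) hIo hIc (fun τ hτ => ?_) (fun τ hτ => hΩ'₁ (hmaps hτ)) σ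
      hσ).congr_deriv (by ring)
    rw [one_smul]
    exact (hγ τ hτ).hasDerivAt (hIo.mem_nhds hτ)
  · refine fun p hp => ⟨⟨_, htr₁ p hp, sep_subset _ _, hp, rfl⟩, ?_⟩
    rintro I γ hIo hIc hγ hmaps σ hσ rfl
    -- The straightened field is `D N^⊥`, so a curve with velocity `N^⊥` has velocity factor `1 /
    -- D`, the source of the `D` in `rot F / D`.
    refine (hgc I γ (fun σ => (density u F (γ σ))⁻¹) hIo hIc (fun τ hτ => ?_)
      (fun τ hτ => hΩ'₂ (hmaps hτ)) σ hσ).congr_deriv (by ring)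
    refine ((hγ τ hτ).hasDerivAt (hIo.mem_nhds hτ)).congr_deriv ?_
    rw [← perp_smul]
    rfl
  · intro p hp
    have hΦ : Φ !₂[s p, -t p] = p := hdiff.2.2.2.2 hp
    refine pullbackMetric_chart (hN1 p (hΩ'Ω hp)) (hfpos p (hΩ'₁ hp)).ne'
      (mul_pos (hgpos p (hΩ'₂ hp)) (hDpos p (hΩ'Ω hp))).ne' (hs p (hΩ'₁ hp))
      (htN p (hΩ'₂ hp)) ?_ ?_
    · rw [hΦ]
    · rw [hΦ, mul_pow]
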